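/- For positive integers $s_1\ge 2, s_2,\dots,s_r$, let $K_r^+(s_1,\dots,s_r)$ denote the complete $r$-partite graph with parts of sizes $s_1,\dots,s_r$, with one edge added inside the first part (the one of size $s_1$). Let $r\ge 2$ and $n\ge 2$ be integers, let $c$ be a real number with $2/\ln n\le c\le r^{-(r+7)(r+1)}/2$, let $\alpha$ be a real number with $0<\alpha<r^{-8}/8$, and let $G$ be a (finite, simple) graph of order $n$. If $G$ has exactly $\left\lceil (1-1/r-\alpha)\,n^2/2\right\rceil$ edges, then $G$ satisfies at least one of the following conditions: (i) $G$ contains, as a not necessarily induced subgraph, a $K_r^+\left(\lfloor c\ln n\rfloor,\dots,\lfloor c\ln n\rfloor,\lceil n^{1-2\sqrt c}\rceil\right)$, where the first $r-1$ parts have size $\lfloor c\ln n\rfloor$ (so the added edge lies in a part of that size) and the last part has size $\lceil n^{1-2\sqrt c}\rceil$; (ii) $G$ contains an induced $r$-partite subgraph $G_0$ of order at least $(1-\sqrt{2\alpha})\,n$ and with minimum degree $\delta(G_0)>(1-1/r-2\sqrt{2\alpha})\,n$. -/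

import Mathlib

/-- The graph `K_r⁺(s₀, …, s_{r-1})`: the complete `r`-partite graph with parts of sizes
`s 0, …, s (r - 1)`, together with one extra edge inside the first part, joining its vertices
number `0` and number `1`. It is meant for `1 ≤ r` and `2 ≤ s 0`. -/
def completePartitePlus (r : ℕ) (s : Fin r → ℕ) : SimpleGraph (Σ i : Fin r, Fin (s i)) :=
  SimpleGraph.completeMultipartiteGraph (fun i : Fin r => Fin (s i)) ⊔
    SimpleGraph.fromRel (fun x y =>
      x.1.val = 0 ∧ y.1.val = 0 ∧ x.2.val = 0 ∧ y.2.val = 1)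

/-! Put ε = √(2α) and let M be the set of vertices of degree at most (1 - 1/r - ε)n. If |M| ≤ εn,
deleting M leaves large minimum degree. Either the rest is K_{r+1}-free, hence r-colorable by the
Andrásfai–Erdős–Sós theorem, which is (ii), or it contains a K_{r+1}. If |M| > εn ≥ 1, deleting ⌊εn⌋
vertices of M pushes the density above Turán's; `exists_subset_large_degree` then yields a large
induced subgraph of large minimum degree, still above Turán's density, so again with a K_{r+1}. When
εn < 1 the floor is 0, and `completePartitePlus_isContained_of_small_deficiency` uses the remainder
term in Turán's theorem instead.

It remains to find K_r⁺ from a K_{r+1} and large minimum degree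
(`completePartitePlus_isContained_of_degree`). Averaging over pairs in the clique gives an edge uv
with a large common neighborhood W. A complete r-partite graph is built with all parts but one
inside W; putting u and v into the remaining part supplies the extra edge.

The parts come from `exists_complete_multipartite`: if every partial tuple extends in a fixed
proportion of ways, a family of tuples can be extended one coordinate at a time, each time keeping
only tuples that share enough extensions. The family shrinks by a constant factor L per step, so it
stays logarithmic in n, while the shared extensions at the last step may form a part of size a power
of n. -/

namespace SimpleGraph

open Finset Function

/-! ### Pigeonhole for common elements of dense sets. -/

/-- If each of `m` sets contains a proportion `b` of the ground set, then some `m'` of them have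
`T` common elements, provided `m'` is at most `b m / 2` and `T` at most `2⁻ᵐ b / 2` times the size
of the ground set. -/
lemma exists_large_common_subset {V : Type*} [Fintype V] [DecidableEq V] {m m' T : ℕ} {b : ℝ}
    (E : Fin m → Finset V) (hE : ∀ i, b * Fintype.card V ≤ #(E i)) (hm : 0 < m) (hT₀ : 0 < T)
    (hm' : 2 * (m' : ℝ) ≤ b * m) (hT : (T : ℝ) * 2 ^ m ≤ b / 2 * Fintype.card V) :
    ∃ I : Fin m' ↪ Fin m, ∃ Y : Finset V, #Y = T ∧ ∀ i, Y ⊆ E (I i) := by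
  classical
  set D : V → Finset (Fin m) := fun y => univ.filter fun i => y ∈ E i with hD
  set Y₀ : Finset V := univ.filter fun y => m' ≤ #(D y) with hY₀
  have hcount : ∑ i, #(E i) = ∑ y, #(D y) := by
    have := sum_card_bipartiteAbove_eq_sum_card_bipartiteBelow (s := (univ : Finset (Fin m)))
      (t := (univ : Finset V)) (fun i y => y ∈ E i)
    simpa [bipartiteAbove, bipartiteBelow, hD] using this
  have hupper : ∑ y, (#(D y) : ℝ) ≤ m * #Y₀ + m' * Fintype.card V := by
    calc ∑ y, (#(D y) : ℝ) ≤ ∑ y, ((if m' ≤ #(D y) then (m : ℝ) else 0) + m') := by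
          refine sum_le_sum fun y _ => ?_
          split_ifs with h
          · have : #(D y) ≤ m := by simpa using card_le_univ (D y)
            have : (#(D y) : ℝ) ≤ m := by exact_mod_cast this
            have : (0 : ℝ) ≤ m' := by positivity
            linarith
          · have : (#(D y) : ℝ) ≤ m' := by exact_mod_cast (not_le.1 h).le
            linarith
      _ = m * #Y₀ + m' * Fintype.card V := by
          rw [sum_add_distrib, ← sum_filter, sum_const, sum_const, card_univ]
          simp [hY₀, mul_comm]
  have hlower : (m : ℝ) * (b * Fintype.card V) ≤ ∑ y, (#(D y) : ℝ) := by
    have h : (∑ i, (#(E i) : ℝ)) = ∑ y, (#(D y) : ℝ) := by exact_mod_cast hcount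
    rw [← h]
    simpa using card_nsmul_le_sum (univ : Finset (Fin m)) (fun i => (#(E i) : ℝ)) _
      fun i _ => hE i
  have hmpos : (0 : ℝ) < m := by exact_mod_cast hm
  have hV : (0 : ℝ) ≤ Fintype.card V := by positivity
  have hY₀card : b / 2 * Fintype.card V ≤ #Y₀ := by
    refine le_of_mul_le_mul_left ?_ hmpos
    nlinarith [mul_le_mul_of_nonneg_right hm' hV]
  -- The elements of `Y₀` fall into at most `2 ^ m` classes according to the sets containing them,
  -- so one class has at least `T` elements.
  obtain ⟨S, -, hS⟩ := exists_le_card_fiber_of_mul_le_card_of_maps_to (s := Y₀)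
    (t := (univ : Finset (Finset (Fin m)))) (f := D) (n := T) (fun _ _ => mem_univ _)
    univ_nonempty (by
      have : (T : ℝ) * 2 ^ m ≤ #Y₀ := hT.trans hY₀card
      rw [card_univ, Fintype.card_finset, Fintype.card_fin, mul_comm]
      exact_mod_cast this)
  obtain ⟨Y, hYS, hYT⟩ := exists_subset_card_eq hS
  obtain ⟨y, hy⟩ : Y.Nonempty := by rw [← card_pos]; omega
  have hSy : m' ≤ #S := by
    have := hYS hy
    simp only [hY₀, mem_filter, mem_univ, true_and] at this
    rw [← this.2]; exact this.1
  obtain ⟨S', hS', hcard⟩ := exists_subset_card_eq hSy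
  refine ⟨(S'.orderEmbOfFin hcard).toEmbedding, Y, hYT, fun i y hy => ?_⟩
  have h1 : D y = S := by
    have := hYS hy
    simp only [mem_filter] at this
    exact this.2
  have h2 : S'.orderEmbOfFin hcard i ∈ D y := h1 ▸ hS' (orderEmbOfFin_mem S' hcard i)
  simpa [hD] using h2

end SimpleGraph

/-! ### Complete multipartite subgraphs from extendable tuples. -/

namespace SimpleGraph

open Finset Function

variable {V : Type*}

/-- The tuples `g 0, …, g (m - 1)` satisfy `P j`; their first `j` coordinates span a complete
`j`-partite subgraph of `G` with `m` vertices in each part, the `p`-th part lying in `R p`. -/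
structure IsTupleSystem (G : SimpleGraph V) (P : ℕ → (ℕ → V) → Prop) (R : ℕ → V → Prop) (j : ℕ)
    {m : ℕ} (g : Fin m → ℕ → V) : Prop where
  prop : ∀ i, P j (g i)
  injective : ∀ p < j, Injective fun i => g i p
  adj : ∀ p < j, ∀ q < j, p ≠ q → ∀ i i', G.Adj (g i p) (g i' q)
  mem : ∀ p < j, ∀ i, R p (g i p)

variable [Fintype V] [DecidableEq V] {G : SimpleGraph V} {P : ℕ → (ℕ → V) → Prop}
  {R : ℕ → V → Prop} {b : ℝ} {j m m' T : ℕ}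

-- Keeping `m'` and `T` independent serves two purposes: `T = m'` in the inductive step, and `T`
-- much larger than `m'` for the last part.
open Classical in
lemma IsTupleSystem.exists_extensions {g : Fin m → ℕ → V} (hg : G.IsTupleSystem P R j g)
    (hext : ∀ f, P j f → b * Fintype.card V ≤ #{y | P (j + 1) (update f j y)}) (hm : 0 < m)
    (hT₀ : 0 < T) (hm' : 2 * (m' : ℝ) ≤ b * m) (hT : (T : ℝ) * 2 ^ m ≤ b / 2 * Fintype.card V) :
    ∃ I : Fin m' ↪ Fin m, ∃ Y : Finset V, #Y = T ∧
      ∀ i, ∀ y ∈ Y, P (j + 1) (update (g (I i)) j y) := by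
  obtain ⟨I, Y, hY, h⟩ := exists_large_common_subset
    (fun i => ({y | P (j + 1) (update (g i) j y)} : Finset V)) (fun i => hext _ (hg.prop i))
    hm hT₀ hm' hT
  exact ⟨I, Y, hY, fun i y hy => by simpa using h i hy⟩

-- The `m'` common extensions are distributed one to each surviving tuple. Since every one of them
-- extends every surviving tuple, the new vertices are adjacent to all old vertices, across
-- different tuples too.
open Classical in
lemma IsTupleSystem.exists_succ {g : Fin m → ℕ → V} (hg : G.IsTupleSystem P R j g)
    (hext : ∀ f, P j f → b * Fintype.card V ≤ #{y | P (j + 1) (update f j y)})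
    (hadj : ∀ f, P (j + 1) f → ∀ p < j, G.Adj (f p) (f j)) (hR : ∀ f, P (j + 1) f → R j (f j))
    (hm : 0 < m) (hm₀ : 0 < m') (hm' : 2 * (m' : ℝ) ≤ b * m)
    (hT : (m' : ℝ) * 2 ^ m ≤ b / 2 * Fintype.card V) :
    ∃ g' : Fin m' → ℕ → V, G.IsTupleSystem P R (j + 1) g' := by
  obtain ⟨I, Y, hY, h⟩ := hg.exists_extensions hext hm hm₀ hm' hT
  let y : Fin m' → V := fun i => (Y.equivFin.symm (Fin.cast hY.symm i) : V)
  have hyY : ∀ i, y i ∈ Y := fun i => (Y.equivFin.symm (Fin.cast hY.symm i)).2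
  have hyinj : Injective y := fun i i' hi => by
    have := Y.equivFin.symm.injective (Subtype.ext hi)
    exact Fin.cast_injective _ this
  have key : ∀ p < j, ∀ i i', G.Adj (g (I i) p) (y i') := fun p hp i i' => by
    simpa [hp.ne] using hadj _ (h i _ (hyY i')) p hp
  refine ⟨fun i => update (g (I i)) j (y i), fun i => h i _ (hyY i), ?_, ?_, ?_⟩
  · intro p hp i i' hi
    rcases (Nat.lt_succ_iff_lt_or_eq.1 hp) with hp | rfl
    · exact I.injective (hg.injective p hp (by simpa [hp.ne] using hi))
    · exact hyinj (by simpa using hi)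
  · intro p hp q hq hpq i i'
    rcases (Nat.lt_succ_iff_lt_or_eq.1 hp) with hp | rfl <;>
      rcases (Nat.lt_succ_iff_lt_or_eq.1 hq) with hq | rfl
    · simpa [hp.ne, hq.ne] using hg.adj p hp q hq hpq _ _
    · simpa [hp.ne] using key p hp i i'
    · simpa [hq.ne] using (key q hq i' i).symm
    · exact absurd rfl hpq
  · intro p hp i
    rcases (Nat.lt_succ_iff_lt_or_eq.1 hp) with hp | rfl
    · simpa [hp.ne] using hg.mem p hp (I i)
    · simpa using hR _ (h i _ (hyY i))

open Classical in
/-- Suppose that every tuple of `j ≤ l` vertices satisfying `P j` extends to one satisfying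
`P (j + 1)` in a proportion `b` of all ways, and that each new vertex is adjacent to the previous
ones. Then `G` contains a complete `(l + 1)`-partite subgraph with `l` parts of logarithmic size
and one large part. -/
theorem exists_complete_multipartite {l s t L : ℕ} (hs : 0 < s) (ht : 0 < t) (hL : 2 ≤ b * L)
    (h₀ : ∃ f, P 0 f)
    (hext : ∀ j ≤ l, ∀ f, P j f → b * Fintype.card V ≤ #{y | P (j + 1) (update f j y)})
    (hadj : ∀ j ≤ l, ∀ f, P (j + 1) f → ∀ p < j, G.Adj (f p) (f j))
    (hR : ∀ j ≤ l, ∀ f, P (j + 1) f → R j (f j))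
    (hsize : ((s * L ^ (l + 1) : ℕ) : ℝ) * 2 ^ (s * L ^ (l + 1)) ≤ b / 2 * Fintype.card V)
    (hsize' : (t : ℝ) * 2 ^ (s * L) ≤ b / 2 * Fintype.card V) :
    ∃ A : ℕ → Finset V, (∀ p < l, #(A p) = s) ∧ #(A l) = t ∧ (∀ p ≤ l, ∀ a ∈ A p, R p a) ∧
      ∀ p ≤ l, ∀ q ≤ l, p ≠ q → ∀ x ∈ A p, ∀ y ∈ A q, G.Adj x y := by
  have hL₀ : 0 < L := by
    rcases Nat.eq_zero_or_pos L with rfl | h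
    · norm_num at hL
    · exact h
  have hsys : ∀ j ≤ l, ∃ g : Fin (s * L ^ (l + 1 - j)) → ℕ → V, G.IsTupleSystem P R j g := by
    intro j
    induction j with
    | zero =>
      obtain ⟨f, hf⟩ := h₀
      -- At `j = 0` no coordinate is constrained yet, so all tuples may be equal.
      exact fun _ => ⟨fun _ => f, fun _ => hf, by simp, by simp, by simp⟩
    | succ j ih =>
      intro hj
      obtain ⟨g, hg⟩ := ih (by omega)
      have hpow : L ^ (l + 1 - j) = L ^ (l + 1 - (j + 1)) * L := by
        rw [← pow_succ]; congr 1; omega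
      refine hg.exists_succ (b := b) (hext j (by omega)) (hadj j (by omega)) (hR j (by omega))
        (by positivity) (by positivity) ?_ ?_
      · rw [hpow]
        simp only [Nat.cast_mul, Nat.cast_pow]
        have := mul_le_mul_of_nonneg_left hL (by positivity : (0 : ℝ) ≤ s * L ^ (l + 1 - (j + 1)))
        linarith
      · refine le_trans ?_ hsize
        have h1 : s * L ^ (l + 1 - (j + 1)) ≤ s * L ^ (l + 1) :=
          Nat.mul_le_mul_left _ (Nat.pow_le_pow_right hL₀ (by omega))
        have h2 : s * L ^ (l + 1 - j) ≤ s * L ^ (l + 1) :=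
          Nat.mul_le_mul_left _ (Nat.pow_le_pow_right hL₀ (by omega))
        exact_mod_cast Nat.mul_le_mul h1 (Nat.pow_le_pow_right (by norm_num) h2)
  obtain ⟨g, hg⟩ := hsys l le_rfl
  -- Only `s * L` tuples are left here, so the loss is merely `2 ^ (s * L)`, and all `t` common
  -- extensions are kept as the last part.
  obtain ⟨I, Y, hY, h⟩ := hg.exists_extensions (m' := s) (hext l le_rfl) (by positivity) ht
    (by
      rw [show l + 1 - l = 1 by omega, pow_one]
      push_cast
      have : (0 : ℝ) ≤ s := by positivity
      nlinarith)
    (by rwa [show l + 1 - l = 1 by omega, pow_one])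
  obtain ⟨A, hlt, heq⟩ : ∃ A : ℕ → Finset V,
      (∀ p < l, A p = univ.image fun i => g (I i) p) ∧ A l = Y :=
    ⟨fun p => if p = l then Y else univ.image fun i => g (I i) p,
      fun p hp => if_neg hp.ne, if_pos rfl⟩
  refine ⟨A, ?_, heq ▸ hY, ?_, ?_⟩
  · intro p hp
    rw [hlt p hp]
    exact (card_image_of_injective _ ((hg.injective p hp).comp I.injective)).trans (by simp)
  · intro p hp a ha
    rcases hp.lt_or_eq with hp | rfl
    · rw [hlt p hp] at ha
      obtain ⟨i, -, rfl⟩ := mem_image.1 ha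
      exact hg.mem p hp _
    · rw [heq] at ha
      simpa using hR p le_rfl _ (h ⟨0, hs⟩ a ha)
  · have key : ∀ p < l, ∀ i, ∀ y ∈ Y, G.Adj (g (I i) p) y := fun p hp i y hy => by
      simpa [hp.ne] using hadj l le_rfl _ (h i y hy) p hp
    intro p hp q hq hpq x hx y hy
    rcases hp.lt_or_eq with hp | rfl <;> rcases hq.lt_or_eq with hq | rfl
    · rw [hlt p hp] at hx
      rw [hlt q hq] at hy
      obtain ⟨i, -, rfl⟩ := mem_image.1 hx
      obtain ⟨i', -, rfl⟩ := mem_image.1 hy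
      exact hg.adj p hp q hq hpq _ _
    · rw [hlt p hp] at hx
      rw [heq] at hy
      obtain ⟨i, -, rfl⟩ := mem_image.1 hx
      exact key p hp i y hy
    · rw [hlt q hq] at hy
      rw [heq] at hx
      obtain ⟨i, -, rfl⟩ := mem_image.1 hy
      exact (key q hq i x hx).symm
    · exact absurd rfl hpq

end SimpleGraph

/-! ### Embedding `completePartitePlus`, and an edge with many common neighbors. -/

namespace SimpleGraph

open Finset Function

variable {V : Type*}

lemma completePartitePlus_isContained {G : SimpleGraph V} {r : ℕ} {s : Fin r → ℕ}
    (F : ∀ i, Fin (s i) → V) (hF : ∀ i, Injective (F i))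
    (hadj : ∀ i i', i ≠ i' → ∀ x y, G.Adj (F i x) (F i' y))
    (hplus : ∀ i : Fin r, i.val = 0 → ∀ x y : Fin (s i), x.val = 0 → y.val = 1 →
      G.Adj (F i x) (F i y)) :
    (completePartitePlus r s).IsContained G := by
  refine ⟨⟨⟨fun x => F x.1 x.2, ?_⟩, ?_⟩⟩
  · rintro ⟨i, x⟩ ⟨i', y⟩ h
    by_cases hi : i = i'
    · subst hi
      simp only [completePartitePlus, sup_adj, fromRel_adj, completeMultipartiteGraph, comap_adj,
        top_adj, ne_eq, not_true_eq_false, false_or] at h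
      rcases h.2 with ⟨h0, -, hx, hy⟩ | ⟨h0, -, hx, hy⟩
      · exact hplus i h0 x y hx hy
      · exact (hplus i h0 y x hx hy).symm
    · exact hadj i i' hi x y
  · rintro ⟨i, x⟩ ⟨i', y⟩ h
    by_cases hi : i = i'
    · subst hi
      exact congrArg (Sigma.mk i) (hF i h)
    · exact absurd h (hadj i i' hi x y).ne

lemma exists_injective_mem {A : Finset V} {m : ℕ} (h : m ≤ #A) :
    ∃ f : Fin m → V, Injective f ∧ ∀ x, f x ∈ A :=
  ⟨fun x => (A.equivFin.symm (Fin.castLE h x) : V),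
    fun _ _ hxy => Fin.castLE_injective h (A.equivFin.symm.injective (Subtype.ext hxy)),
    fun x => (A.equivFin.symm (Fin.castLE h x)).2⟩

/-- Used to place the extra edge at the two distinguished positions of the first part. Removing `u`
and `v` from `A` leaves at least `m - 2` vertices whether or not they belong to it. -/
lemma exists_injective_mem_of_pair [DecidableEq V] {A : Finset V} {m : ℕ} {u v : V} (hm : 2 ≤ m)
    (h : m ≤ #A) (huv : u ≠ v) :
    ∃ f : Fin m → V, Injective f ∧ (∀ x, f x = u ∨ f x = v ∨ f x ∈ A) ∧
      (∀ x, x.val = 0 → f x = u) ∧ ∀ x, x.val = 1 → f x = v := by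
  obtain ⟨m, rfl⟩ := Nat.exists_eq_add_of_le' hm
  obtain ⟨g, hg, hgA⟩ := exists_injective_mem (A := A \ {u, v}) (m := m) (by
    have h1 := le_card_sdiff {u, v} A
    have h2 : #({u, v} : Finset V) ≤ 2 := card_le_two
    omega)
  have hgu : ∀ x, g x ≠ u := fun x hx => by simpa [hx] using hgA x
  have hgv : ∀ x, g x ≠ v := fun x hx => by simpa [hx] using hgA x
  refine ⟨Fin.cons u (Fin.cons v g), ?_, ?_, ?_, ?_⟩
  · rw [Fin.cons_injective_iff, Fin.cons_injective_iff]
    refine ⟨?_, ?_, hg⟩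
    · rintro ⟨x, hx⟩
      induction x using Fin.cases with
      | zero => exact huv (by simpa using hx.symm)
      | succ x => exact hgu x (by simpa using hx)
    · rintro ⟨x, hx⟩
      exact hgv x hx
  · intro x
    induction x using Fin.cases with
    | zero => simp
    | succ x =>
      induction x using Fin.cases with
      | zero => simp
      | succ x =>
        right; right
        have := hgA x
        simp only [mem_sdiff] at this
        simpa using this.1
  · intro x hx
    obtain rfl : x = 0 := Fin.ext hx
    simp
  · intro x hx
    obtain rfl : x = Fin.succ 0 := Fin.ext hx
    simp

variable [Fintype V] [DecidableEq V] {G : SimpleGraph V} [DecidableRel G.Adj]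

/-- In a clique of `r + 1` vertices of large degree, some two vertices have many common
neighbors. -/
lemma exists_adj_le_card_common_neighbors {r : ℕ} {β : ℝ} (hr : 2 ≤ r) [Nonempty V]
    (hβ : ((r : ℝ) + 2) * (r ^ 2 - 1) * r * β ≤ 2)
    (hdeg : ∀ v, (Fintype.card V : ℝ) - G.degree v ≤ (1 / r + β) * Fintype.card V)
    (hclique : ¬ G.CliqueFree (r + 1)) :
    ∃ u v, G.Adj u v ∧ (1 - 2 / r + (r - 1) * β) * Fintype.card V ≤
      #(G.neighborFinset u ∩ G.neighborFinset v) := by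
  obtain ⟨Q, hQ⟩ : ∃ Q, G.IsNClique (r + 1) Q := by simpa [CliqueFree] using hclique
  by_contra! hcon
  have hk : (0 : ℝ) < Fintype.card V := by exact_mod_cast Fintype.card_pos
  set k : ℝ := (Fintype.card V : ℝ) with hkdef
  have hr' : (2 : ℝ) ≤ r := by exact_mod_cast hr
  have hQcard : (#Q : ℝ) = r + 1 := by rw [hQ.card_eq]; push_cast; ring
  have hoff : (#Q.offDiag : ℝ) = r * (r + 1) := by
    rw [offDiag_card, Nat.cast_sub (Nat.le_mul_self _)]
    push_cast
    rw [hQcard]; ring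
  let d : V → ℕ := fun x => #(Q.filter fun a => G.Adj a x)
  have hcount : ∑ p ∈ Q.offDiag, #(G.neighborFinset p.1 ∩ G.neighborFinset p.2) =
      ∑ x, (d x * d x - d x) := by
    have := sum_card_bipartiteAbove_eq_sum_card_bipartiteBelow (s := Q.offDiag)
      (t := (univ : Finset V)) (fun p x => G.Adj p.1 x ∧ G.Adj p.2 x)
    convert this using 2 with p hp x hx
    · congr 1
      ext x
      simp [bipartiteAbove]
    · rw [← offDiag_card]
      congr 1
      ext ⟨a, c⟩
      simp only [mem_offDiag, mem_filter, bipartiteBelow]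
      tauto
  have hdsum : ∑ x, d x = ∑ a ∈ Q, G.degree a := by
    have := sum_card_bipartiteAbove_eq_sum_card_bipartiteBelow (s := Q)
      (t := (univ : Finset V)) (fun a x => G.Adj a x)
    refine this.symm.trans (sum_congr rfl fun a _ => ?_)
    rw [← card_neighborFinset_eq_degree]
    congr 1
    ext x
    simp [bipartiteAbove]
  have hdsum' : ((r : ℝ) + 1) * ((1 - 1 / r - β) * k) ≤ ∑ x, (d x : ℝ) := by
    have h1 : (∑ x, (d x : ℝ)) = ∑ a ∈ Q, (G.degree a : ℝ) := by exact_mod_cast hdsum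
    rw [h1, ← hQcard, ← nsmul_eq_mul]
    exact card_nsmul_le_sum _ _ _ fun a _ => by linarith [hdeg a]
  -- A linear minorant of d² - d, tight at d = r - 1 and d = r; no integer lies strictly between, so
  -- (d - r)(d - r + 1) ≥ 0.
  have hconv : ∀ x, (2 * r - 2 : ℝ) * d x - r * (r - 1) ≤ ((d x * d x - d x : ℕ) : ℝ) := by
    intro x
    rw [Nat.cast_sub (Nat.le_mul_self _)]
    push_cast
    have : (0 : ℤ) ≤ ((d x : ℤ) - r) * (d x - (r - 1)) := by
      rcases lt_or_ge (d x : ℤ) r with h | h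
      · exact mul_nonneg_of_nonpos_of_nonpos (by linarith) (by linarith [Int.le_sub_one_of_lt h])
      · exact mul_nonneg (by linarith) (by linarith)
    have : (0 : ℝ) ≤ ((d x : ℝ) - r) * (d x - (r - 1)) := by exact_mod_cast this
    nlinarith
  have hlow : (2 * r - 2 : ℝ) * ∑ x, (d x : ℝ) - r * (r - 1) * k ≤
      ∑ x, ((d x * d x - d x : ℕ) : ℝ) := by
    refine le_trans (le_of_eq ?_) (sum_le_sum fun x _ => hconv x)
    rw [sum_sub_distrib, ← mul_sum]
    simp [hkdef, mul_comm]
  have hup : ∑ p ∈ Q.offDiag, (#(G.neighborFinset p.1 ∩ G.neighborFinset p.2) : ℝ) <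
      r * (r + 1) * ((1 - 2 / r + (r - 1) * β) * k) := by
    rw [← hoff, ← nsmul_eq_mul, ← sum_const]
    refine sum_lt_sum_of_nonempty ?_ fun p hp => ?_
    · rw [← card_pos]
      have : (0 : ℝ) < #Q.offDiag := by rw [hoff]; positivity
      exact_mod_cast this
    · rw [mem_offDiag] at hp
      exact hcon _ _ (hQ.isClique hp.1 hp.2.1 hp.2.2)
  have hcount' : ∑ p ∈ Q.offDiag, (#(G.neighborFinset p.1 ∩ G.neighborFinset p.2) : ℝ) =
      ∑ x, ((d x * d x - d x : ℕ) : ℝ) := by exact_mod_cast hcount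
  have hfin : (2 * r - 2 : ℝ) * (((r : ℝ) + 1) * ((1 - 1 / r - β) * k)) - r * (r - 1) * k <
      r * (r + 1) * ((1 - 2 / r + (r - 1) * β) * k) := by
    have := mul_le_mul_of_nonneg_left hdsum' (by linarith : (0 : ℝ) ≤ 2 * r - 2)
    linarith
  have hfin' : (2 * r - 2 : ℝ) * ((r + 1) * (1 - 1 / r - β)) - r * (r - 1) <
      r * (r + 1) * (1 - 2 / r + (r - 1) * β) := by
    refine lt_of_mul_lt_mul_right ?_ hk.le
    linarith
  -- With denominators cleared, `hfin'` becomes 2 < (r + 2)(r² - 1)rβ, the exact negation of `hβ`.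
  have e1 : (r : ℝ) * ((2 * r - 2 : ℝ) * ((r + 1) * (1 - 1 / r - β)) - r * (r - 1)) =
      (2 * r - 2) * (r + 1) * (r - 1 - r * β) - r * r * (r - 1) := by
    field_simp
  have e2 : (r : ℝ) * (r * (r + 1) * (1 - 2 / r + (r - 1) * β)) =
      r * (r + 1) * (r - 2 + r * (r - 1) * β) := by
    field_simp
  have := mul_lt_mul_of_pos_left hfin' (by linarith : (0 : ℝ) < r)
  rw [e1, e2] at this
  nlinarith

end SimpleGraph

/-! ### From a clique and large degrees to `completePartitePlus`. -/

namespace SimpleGraph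

open Finset Function

variable {V : Type*} [Fintype V] {G : SimpleGraph V} [DecidableRel G.Adj]

/-- If every vertex has at most `m` non-neighbors, then `j` vertices have at least `#W - j * m`
common neighbors in `W`. -/
lemma card_sub_le_card_common_neighbors [DecidableEq V] {m : ℝ} (W : Finset V)
    (hdeg : ∀ v, (Fintype.card V : ℝ) - G.degree v ≤ m) (f : ℕ → V) (j : ℕ) :
    (#W : ℝ) - j * m ≤ #{w ∈ W | ∀ p < j, G.Adj (f p) w} := by
  induction j with
  | zero => simp
  | succ j ih =>
    have hsub : {w ∈ W | ∀ p < j, G.Adj (f p) w} \ (G.neighborFinset (f j))ᶜ ⊆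
        {w ∈ W | ∀ p < j + 1, G.Adj (f p) w} := by
      intro w hw
      simp only [mem_sdiff, mem_filter, mem_compl, mem_neighborFinset, not_not] at hw
      simp only [mem_filter]
      refine ⟨hw.1.1, fun p hp => ?_⟩
      rcases Nat.lt_succ_iff_lt_or_eq.1 hp with hp | rfl
      · exact hw.1.2 p hp
      · exact hw.2
    have h1 := card_le_card hsub
    have h2 := le_card_sdiff (G.neighborFinset (f j))ᶜ {w ∈ W | ∀ p < j, G.Adj (f p) w}
    have h3 : #(G.neighborFinset (f j)) + #(G.neighborFinset (f j))ᶜ = Fintype.card V :=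
      card_add_card_compl _
    rw [card_neighborFinset_eq_degree] at h3
    have h4 : #{w ∈ W | ∀ p < j, G.Adj (f p) w} + G.degree (f j) ≤
        #{w ∈ W | ∀ p < j + 1, G.Adj (f p) w} + Fintype.card V := by omega
    have h5 : (#{w ∈ W | ∀ p < j, G.Adj (f p) w} : ℝ) + G.degree (f j) ≤
        #{w ∈ W | ∀ p < j + 1, G.Adj (f p) w} + Fintype.card V := by exact_mod_cast h4
    have := hdeg (f j)
    push_cast
    linarith

open Classical in
/-- If each of at least `a k` vertices in `W` has at least `a k` neighbors in `X`, where `k` is the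
number of all vertices, then at least `a ^ 2 k / 2` vertices of `X` have at least `a ^ 2 k / 2`
neighbors in `W`. -/
lemma card_filter_many_neighbors {a : ℝ} (W X : Finset V)
    (hW : a * Fintype.card V ≤ #W) (ha : 0 ≤ a)
    (hX : ∀ w ∈ W, a * Fintype.card V ≤ #{x ∈ X | G.Adj x w}) :
    a ^ 2 / 2 * Fintype.card V ≤
      #{x ∈ X | a ^ 2 / 2 * Fintype.card V ≤ #{w ∈ W | G.Adj x w}} := by
  rcases isEmpty_or_nonempty V with hV | hV
  · simp
  have hk : (0 : ℝ) < Fintype.card V := by exact_mod_cast Fintype.card_pos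
  set k : ℝ := (Fintype.card V : ℝ) with hkdef
  have hcount : ∑ x ∈ X, #{w ∈ W | G.Adj x w} = ∑ w ∈ W, #{x ∈ X | G.Adj x w} :=
    sum_card_bipartiteAbove_eq_sum_card_bipartiteBelow (s := X) (t := W) (fun x w => G.Adj x w)
  have hcount' : ∑ x ∈ X, (#{w ∈ W | G.Adj x w} : ℝ) = ∑ w ∈ W, (#{x ∈ X | G.Adj x w} : ℝ) := by
    exact_mod_cast hcount
  have hlow : (a * k) * (a * k) ≤ ∑ w ∈ W, (#{x ∈ X | G.Adj x w} : ℝ) := by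
    refine (mul_le_mul_of_nonneg_right hW (by positivity)).trans ?_
    rw [← nsmul_eq_mul]
    exact card_nsmul_le_sum _ _ _ hX
  have hXk : (#X : ℝ) ≤ k := Nat.cast_le.2 (card_le_univ X)
  have hup : ∑ x ∈ X, (#{w ∈ W | G.Adj x w} : ℝ) ≤
      #{x ∈ X | a ^ 2 / 2 * k ≤ #{w ∈ W | G.Adj x w}} * k + k * (a ^ 2 / 2 * k) := by
    calc ∑ x ∈ X, (#{w ∈ W | G.Adj x w} : ℝ)
        ≤ ∑ x ∈ X, ((if a ^ 2 / 2 * k ≤ #{w ∈ W | G.Adj x w} then k else 0) +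
            a ^ 2 / 2 * k) := by
          refine sum_le_sum fun x _ => ?_
          split_ifs with h
          · have : (#{w ∈ W | G.Adj x w} : ℝ) ≤ k := Nat.cast_le.2 (card_le_univ _)
            have : 0 ≤ a ^ 2 / 2 * k := by positivity
            linarith
          · linarith [not_le.1 h]
      _ = #{x ∈ X | a ^ 2 / 2 * k ≤ #{w ∈ W | G.Adj x w}} * k + #X * (a ^ 2 / 2 * k) := by
          rw [sum_add_distrib, ← sum_filter, sum_const, sum_const, nsmul_eq_mul, nsmul_eq_mul]
      _ ≤ _ := by gcongr
  refine le_of_mul_le_mul_right ?_ hk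
  nlinarith

/-- A graph of large minimum degree that contains a clique on `e + 3` vertices contains a large
complete `(e + 2)`-partite graph with an extra edge in the first part. -/
theorem completePartitePlus_isContained_of_degree [DecidableEq V] {e s t L : ℕ} {β : ℝ} [Nonempty V]
    (hβ₀ : 0 ≤ β) (hβ : (((e + 2 : ℕ) : ℝ) + 2) * (((e + 2 : ℕ) : ℝ) ^ 2 - 1) * (e + 2 : ℕ) * β ≤ 2)
    (hβ' : ((e + 2 : ℕ) : ℝ) ^ 2 * β ≤ 1)
    (hdeg : ∀ v, (Fintype.card V : ℝ) - G.degree v ≤ (1 / (e + 2 : ℕ) + β) * Fintype.card V)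
    (hclique : ¬ G.CliqueFree (e + 2 + 1)) (hs : 2 ≤ s) (ht : 0 < t) (hL : 2 ≤ β ^ 2 / 2 * L)
    (hsize : ((s * L ^ (e + 2) : ℕ) : ℝ) * 2 ^ (s * L ^ (e + 2)) ≤
      β ^ 2 / 2 / 2 * Fintype.card V)
    (hsize' : (t : ℝ) * 2 ^ (s * L) ≤ β ^ 2 / 2 / 2 * Fintype.card V) :
    (completePartitePlus (e + 2) (fun i => if i.val + 1 = e + 2 then t else s)).IsContained G := by
  classical
  obtain ⟨u, v, huv, hW⟩ :=
    exists_adj_le_card_common_neighbors (by omega) hβ hdeg hclique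
  set W := G.neighborFinset u ∩ G.neighborFinset v with hWdef
  have hk : (0 : ℝ) < Fintype.card V := by exact_mod_cast Fintype.card_pos
  set k : ℝ := (Fintype.card V : ℝ) with hkdef
  set r : ℝ := ((e + 2 : ℕ) : ℝ) with hr
  have her : (e : ℝ) = r - 2 := by rw [hr]; push_cast; ring
  have hr2 : 2 ≤ r := by rw [hr]; push_cast; linarith [Nat.cast_nonneg (α := ℝ) e]
  have hr0 : 0 < r := by linarith
  have hmiss : 0 ≤ (1 / r + β) * k := by positivity
  have hβ1 : β ≤ 1 := by nlinarith
  have hβsq : β ^ 2 / 2 * k ≤ β * k := by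
    have : β ^ 2 ≤ β := by nlinarith
    nlinarith
  have hrinv : r * (1 / r) = 1 := by field_simp
  -- Up to r - 2 vertices each miss at most (1/r + β)k vertices, and the size of `W` is such that
  -- exactly βk survive in the worst case.
  have hextW : ∀ f : ℕ → V, ∀ j ≤ e, β * k ≤ #{w ∈ W | ∀ p < j, G.Adj (f p) w} := by
    intro f j hj
    refine le_trans ?_ (card_sub_le_card_common_neighbors W hdeg f j)
    have hj' : (j : ℝ) ≤ r - 2 := by rw [← her]; exact_mod_cast hj
    have h1 := mul_le_mul_of_nonneg_right hj' hmiss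
    have h2 : (1 - 2 / r + (r - 1) * β) * k - (r - 2) * ((1 / r + β) * k) = β * k := by
      field_simp; ring
    linarith
  have hextV : ∀ f : ℕ → V, β * k ≤ #{w | ∀ p < e + 1, G.Adj (f p) w} := by
    intro f
    refine le_trans ?_ (card_sub_le_card_common_neighbors univ hdeg f (e + 1))
    rw [card_univ, ← hkdef]
    push_cast
    rw [her]
    have h2 : k - (r - 2 + 1) * ((1 / r + β) * k) = (1 / r - (r - 1) * β) * k := by
      field_simp; ring
    rw [h2]
    refine mul_le_mul_of_nonneg_right ?_ hk.le
    refine le_of_mul_le_mul_left ?_ hr0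
    nlinarith
  -- Only coordinate `e` may leave `W`. A further vertex could exhaust the candidates in `W`, so
  -- coordinate `e` is also required to keep many of them for coordinate `e + 1`.
  let P : ℕ → (ℕ → V) → Prop := fun j f => (∀ p < j, p ≠ e → f p ∈ W) ∧
    (∀ p < j, ∀ q < p, G.Adj (f q) (f p)) ∧
    (e < j → β ^ 2 / 2 * k ≤ #{w ∈ W | ∀ p < e + 1, G.Adj (f p) w})
  have hstep : ∀ j f y, P j f → (j ≠ e → y ∈ W) → (∀ p < j, G.Adj (f p) y) →
      (j = e → β ^ 2 / 2 * k ≤ #{w ∈ W | ∀ p < e + 1, G.Adj (update f j y p) w}) →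
      P (j + 1) (update f j y) := by
    intro j f y hP hy hadj hlast
    refine ⟨fun p hp hpe => ?_, fun p hp q hq => ?_, fun he => ?_⟩
    · rcases Nat.lt_succ_iff_lt_or_eq.1 hp with hp | rfl
      · simpa [hp.ne] using hP.1 p hp hpe
      · simpa using hy hpe
    · rcases Nat.lt_succ_iff_lt_or_eq.1 hp with hp | rfl
      · simpa [hp.ne, (hq.trans hp).ne] using hP.2.1 p hp q hq
      · simpa [hq.ne] using hadj q hq
    · rcases Nat.lt_succ_iff_lt_or_eq.1 he with he | rfl
      · refine (hP.2.2 he).trans (le_of_eq ?_)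
        congr 3
        ext w
        refine forall₂_congr fun p hp => ?_
        rw [update_of_ne (by omega)]
      · exact hlast rfl
  have hext : ∀ j ≤ e + 1, ∀ f, P j f →
      β ^ 2 / 2 * k ≤ #{y | P (j + 1) (update f j y)} := by
    intro j hj f hf
    rcases Nat.lt_or_ge j e with hje | hje
    · refine (hβsq.trans (hextW f j hje.le)).trans ?_
      refine Nat.cast_le.2 (card_le_card fun y hy => ?_)
      rw [mem_filter] at hy
      exact mem_filter.2 ⟨mem_univ _, hstep j f y hf (fun _ => hy.1) hy.2 fun h => by omega⟩
    · rcases hje.lt_or_eq with hje | rfl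
      · obtain rfl : j = e + 1 := by omega
        refine (hf.2.2 (by omega)).trans ?_
        refine Nat.cast_le.2 (card_le_card fun y hy => ?_)
        rw [mem_filter] at hy
        exact mem_filter.2 ⟨mem_univ _, hstep _ f y hf (fun _ => hy.1) hy.2 fun h => by omega⟩
      -- Case `j = e`. Each candidate w in `W`, together with the first `e` vertices, has at least
      -- βk common neighbors by `hextV`; double counting then gives β²k/2 choices of the new vertex
      -- that keep β²k/2 candidates.
      · refine (card_filter_many_neighbors (G := G) {w ∈ W | ∀ p < e, G.Adj (f p) w}
          {x | ∀ p < e, G.Adj (f p) x} (hextW f e le_rfl) hβ₀ fun w hw => ?_).trans ?_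
        · refine (hextV (update f e w)).trans ?_
          refine Nat.cast_le.2 (card_le_card fun x hx => ?_)
          simp only [mem_filter, mem_univ, true_and] at hx ⊢
          refine ⟨fun p hp => ?_, ?_⟩
          · simpa [hp.ne] using hx p (by omega)
          · simpa using (hx e (by omega)).symm
        · refine Nat.cast_le.2 (card_le_card fun x hx => ?_)
          simp only [mem_filter, mem_univ, true_and] at hx
          refine mem_filter.2 ⟨mem_univ _, hstep e f x hf (fun h => absurd rfl h) hx.1 fun _ => ?_⟩
          refine hx.2.trans (Nat.cast_le.2 (card_le_card fun w hw => ?_))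
          simp only [mem_filter] at hw ⊢
          refine ⟨hw.1.1, fun p hp => ?_⟩
          rcases Nat.lt_succ_iff_lt_or_eq.1 hp with hp | rfl
          · simpa [hp.ne] using hw.1.2 p hp
          · simpa using hw.2
  obtain ⟨A, hAs, hAt, hAW, hA⟩ := exists_complete_multipartite (G := G) (P := P)
    (R := fun p a => p ≠ e → a ∈ W) (b := β ^ 2 / 2) (l := e + 1) (s := s) (t := t) (L := L)
    (by omega) ht hL ⟨fun _ => u, by simp [P]⟩
    (fun j hj f hf => by convert hext j hj f hf) (fun j _ f hf p hp => hf.2.1 j (by omega) p hp)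
    (fun j _ f hf => hf.1 j (by omega)) hsize hsize'
  have hAu : ∀ p ≤ e + 1, p ≠ e → ∀ a ∈ A p, G.Adj u a ∧ G.Adj v a := by
    intro p hp hpe a ha
    simpa [hWdef] using hAW p hp a ha hpe
  -- Reorders the parts: the part not confined to `W` comes first, to receive u and v, and the large
  -- part stays last.
  let π : ℕ → ℕ := fun i => if i = 0 then e else if i = e + 1 then e + 1 else i - 1
  have hπ : ∀ i : Fin (e + 2), π i ≤ e + 1 := fun i => by
    simp only [π]; split_ifs <;> omega
  have hπe : ∀ i : Fin (e + 2), i.val ≠ 0 → π i ≠ e := fun i hi => by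
    simp only [π]; split_ifs <;> omega
  have hπinj : ∀ i i' : Fin (e + 2), i ≠ i' → π i ≠ π i' := fun i i' hi => by
    have : i.val ≠ i'.val := fun h => hi (Fin.ext h)
    simp only [π]; split_ifs <;> omega
  have hcard : ∀ i : Fin (e + 2), (if i.val + 1 = e + 2 then t else s) ≤ #(A (π i)) := by
    intro i
    split_ifs with h
    · have : π i = e + 1 := by simp only [π]; split_ifs <;> omega
      rw [this, hAt]
    · have : π i < e + 1 := by simp only [π]; split_ifs <;> omega
      rw [hAs _ this]
  have hF : ∀ i : Fin (e + 2), ∃ F : Fin (if i.val + 1 = e + 2 then t else s) → V,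
      Injective F ∧ (∀ x, F x ∈ A (π i) ∨ i.val = 0 ∧ (F x = u ∨ F x = v)) ∧
      (i.val = 0 → (∀ x, x.val = 0 → F x = u) ∧ ∀ x, x.val = 1 → F x = v) := by
    intro i
    by_cases hi : i.val = 0
    · obtain ⟨F, hFi, hFA, hFu, hFv⟩ := exists_injective_mem_of_pair
        (by rwa [if_neg (by omega)]) (hcard i) huv.ne
      exact ⟨F, hFi, fun x => by have := hFA x; tauto, fun _ => ⟨hFu, hFv⟩⟩
    · obtain ⟨F, hFi, hFA⟩ := exists_injective_mem (hcard i)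
      exact ⟨F, hFi, fun x => Or.inl (hFA x), fun h => absurd h hi⟩
  choose F hFi hFA hFuv using hF
  refine completePartitePlus_isContained F hFi ?_ ?_
  · intro i i' hi x y
    rcases hFA i x with hx | ⟨hi0, hx⟩ <;> rcases hFA i' y with hy | ⟨hi0', hy⟩
    · exact hA _ (hπ i) _ (hπ i') (hπinj i i' hi) _ hx _ hy
    · have := hAu _ (hπ i) (hπe i fun h => hi (Fin.ext (h.trans hi0'.symm))) _ hx
      rcases hy with hy | hy <;> rw [hy]
      · exact this.1.symm
      · exact this.2.symm
    · have := hAu _ (hπ i') (hπe i' fun h => hi (Fin.ext (hi0.trans h.symm))) _ hy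
      rcases hx with hx | hx <;> rw [hx]
      · exact this.1
      · exact this.2
    · exact absurd (Fin.ext (hi0.trans hi0'.symm)) hi
  · intro i hi x y hx hy
    rw [(hFuv i hi).1 x hx, (hFuv i hi).2 y hy]
    exact huv

end SimpleGraph

/-! ### Degree sums, Turán's bound and passage to large minimum degree. -/

namespace SimpleGraph

open Finset Function

variable {V : Type*} (G : SimpleGraph V) [DecidableRel G.Adj]

/-- The sum of the degrees of the subgraph of `G` induced by `U`. -/
def degreeSumOn (U : Finset V) : ℕ := ∑ v ∈ U, #{w ∈ U | G.Adj v w}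

lemma degreeSumOn_univ [Fintype V] : G.degreeSumOn univ = 2 * #G.edgeFinset := by
  rw [← sum_degrees_eq_twice_card_edges]
  refine sum_congr rfl fun v _ => ?_
  rw [← card_neighborFinset_eq_degree, neighborFinset_eq_filter]

lemma degreeSumOn_le_sq (U : Finset V) : G.degreeSumOn U ≤ #U ^ 2 := by
  rw [sq, ← smul_eq_mul]
  exact sum_le_card_nsmul _ _ _ fun v _ => card_filter_le _ _

variable {G}

/-- The degree sum counts ordered adjacent pairs; those meeting `M` have their first or their second
entry in `M`. -/
lemma degreeSumOn_le_sdiff_add [DecidableEq V] {U M : Finset V} (hM : M ⊆ U) :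
    G.degreeSumOn U ≤ G.degreeSumOn (U \ M) + 2 * ∑ v ∈ M, #{w ∈ U | G.Adj v w} := by
  have hsplit : ∀ v, #{w ∈ U | G.Adj v w} = #{w ∈ U \ M | G.Adj v w} + #{w ∈ M | G.Adj v w} := by
    intro v
    rw [← card_union_of_disjoint (disjoint_filter_filter sdiff_disjoint), ← filter_union,
      sdiff_union_of_subset hM]
  have hswap : ∑ v ∈ U \ M, #{w ∈ M | G.Adj v w} = ∑ w ∈ M, #{v ∈ U \ M | G.Adj w v} := by
    refine (sum_card_bipartiteAbove_eq_sum_card_bipartiteBelow G.Adj).trans ?_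
    simp only [bipartiteBelow, G.adj_comm]
  have hle : ∑ w ∈ M, #{v ∈ U \ M | G.Adj w v} ≤ ∑ v ∈ M, #{w ∈ U | G.Adj v w} :=
    sum_le_sum fun v _ => card_le_card (filter_subset_filter _ sdiff_subset)
  unfold degreeSumOn
  rw [← sum_sdiff hM, sum_congr rfl (fun v (_ : v ∈ U \ M) => hsplit v), sum_add_distrib, hswap]
  omega

lemma degree_induce_eq (U : Finset V) (v : (U : Set V)) [Fintype ((G.induce U).neighborSet v)] :
    (G.induce (U : Set V)).degree v = #{w ∈ U | G.Adj v w} := by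
  classical
  rw [← card_neighborFinset_eq_degree, ← card_map (Embedding.subtype _)]
  congr 1
  ext w
  simp only [mem_map, mem_neighborFinset, comap_adj, Embedding.subtype_apply, mem_filter]
  constructor
  · rintro ⟨a, ha, rfl⟩
    exact ⟨a.2, ha⟩
  · rintro ⟨hw, ha⟩
    exact ⟨⟨w, hw⟩, ha, rfl⟩

lemma degreeSumOn_eq_two_mul_card_edgeFinset_induce (U : Finset V)
    [Fintype (G.induce (U : Set V)).edgeSet] :
    G.degreeSumOn U = 2 * #(G.induce (U : Set V)).edgeFinset := by
  classical
  have h := (G.induce (U : Set V)).sum_degrees_eq_twice_card_edges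
  simp only [degree_induce_eq] at h
  rw [degreeSumOn, ← sum_coe_sort]
  convert h

/-- **Turán's theorem**, with the precise bound cleared of denominators. -/
lemma CliqueFree.two_mul_card_edgeFinset_le [Fintype V] {r : ℕ} (hr : 0 < r)
    (h : G.CliqueFree (r + 1)) :
    r * (2 * (#G.edgeFinset : ℝ)) + (Fintype.card V % r : ℕ) * (r - (Fintype.card V % r : ℕ)) ≤
      (r - 1) * (Fintype.card V : ℝ) ^ 2 := by
  have h1 := h.card_edgeFinset_le
  simp only at h1
  set n := Fintype.card V
  set s := n % r
  have hsn : s ≤ n := Nat.mod_le _ _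
  have h2 : (((n ^ 2 - s ^ 2) * (r - 1) / (2 * r) : ℕ) : ℝ) ≤
      ((n : ℝ) ^ 2 - s ^ 2) * (r - 1) / (2 * r) := by
    refine Nat.cast_div_le.trans (le_of_eq ?_)
    rw [Nat.cast_mul, Nat.cast_sub (Nat.pow_le_pow_left hsn 2), Nat.cast_sub hr]
    push_cast
    ring
  have h3 : (#G.edgeFinset : ℝ) ≤ ((n : ℝ) ^ 2 - s ^ 2) * (r - 1) / (2 * r) + s * (s - 1) / 2 := by
    rw [← Nat.cast_choose_two ℝ s]
    have : (#G.edgeFinset : ℝ) ≤ (((n ^ 2 - s ^ 2) * (r - 1) / (2 * r) : ℕ) : ℝ) +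
      (s.choose 2 : ℝ) := by exact_mod_cast h1
    linarith
  have hr' : (0 : ℝ) < r := by exact_mod_cast hr
  have h4 := mul_le_mul_of_nonneg_left h3 (by positivity : (0 : ℝ) ≤ 2 * r)
  have h5 : (2 * r : ℝ) * (((n : ℝ) ^ 2 - s ^ 2) * (r - 1) / (2 * r) + s * (s - 1) / 2) =
      ((n : ℝ) ^ 2 - s ^ 2) * (r - 1) + r * (s * (s - 1)) := by
    field_simp
  rw [h5] at h4
  linarith

lemma not_cliqueFree_induce_of_lt {r : ℕ} (hr : 0 < r) {U : Finset V}
    (h : (1 - 1 / r : ℝ) * (#U : ℝ) ^ 2 < G.degreeSumOn U) :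
    ¬ (G.induce (U : Set V)).CliqueFree (r + 1) := by
  classical
  intro hfree
  have h1 := hfree.two_mul_card_edgeFinset_le hr
  have h2 := degreeSumOn_eq_two_mul_card_edgeFinset_induce (G := G) U
  have h2' : (G.degreeSumOn U : ℝ) = 2 * #(G.induce (U : Set V)).edgeFinset := by exact_mod_cast h2
  rw [← h2'] at h1
  have hcard : Fintype.card (U : Set V) = #U := by simp
  rw [hcard] at h1
  have hr' : (0 : ℝ) < r := by exact_mod_cast hr
  have hmod : ((#U % r : ℕ) : ℝ) ≤ r := by exact_mod_cast (Nat.mod_lt _ hr).le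
  have h3 : (0 : ℝ) ≤ (#U % r : ℕ) * (r - (#U % r : ℕ)) :=
    mul_nonneg (by positivity) (by linarith)
  have h4 := mul_lt_mul_of_pos_left h hr'
  have h5 : (r : ℝ) * ((1 - 1 / r : ℝ) * (#U : ℝ) ^ 2) = (r - 1) * (#U : ℝ) ^ 2 := by
    field_simp
  linarith

/-- A graph with more edges than the balanced `r`-partite density contains a large induced subgraph
with the same property and large minimum degree. -/
lemma exists_subset_large_degree [DecidableEq V] {r : ℕ} {β : ℝ} {U₀ : Finset V} (hr : 0 < r)
    (hβ : 0 < β) (hU₀ : 1 + 2 / (r * β) ≤ β ^ 2 * (#U₀ : ℝ) ^ 2)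
    (h : (1 - 1 / r : ℝ) * (#U₀ : ℝ) ^ 2 < G.degreeSumOn U₀) :
    ∃ U ⊆ U₀, (#U₀ : ℝ) ^ 2 ≤ (1 + 2 / (r * β)) * (#U : ℝ) ^ 2 ∧
      (1 - 1 / r : ℝ) * (#U : ℝ) ^ 2 < G.degreeSumOn U ∧
      ∀ v ∈ U, (1 - 1 / r - β) * #U < #{w ∈ U | G.Adj v w} := by
  -- The term with β/2 is a surplus that grows as `U` shrinks. As the degree sum is at most |U|², it
  -- keeps `U` from becoming small, and a smallest `U` with this property has no vertex of small
  -- degree.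
  let Q : Finset V → Prop := fun U => (1 - 1 / r : ℝ) * (#U : ℝ) ^ 2 +
    β / 2 * ((#U₀ : ℝ) ^ 2 - (#U : ℝ) ^ 2) < G.degreeSumOn U
  classical
  have hr' : (0 : ℝ) < r := by exact_mod_cast hr
  obtain ⟨U, hU, hmin⟩ := exists_min_image (U₀.powerset.filter Q) card
    ⟨U₀, by simp only [mem_filter, mem_powerset, subset_refl, true_and, Q]; linarith⟩
  rw [mem_filter, mem_powerset] at hU
  obtain ⟨hUU₀, hQ⟩ := hU
  have hcardle : (#U : ℝ) ^ 2 ≤ (#U₀ : ℝ) ^ 2 := by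
    have := card_le_card hUU₀
    gcongr
  have hsq : (G.degreeSumOn U : ℝ) ≤ (#U : ℝ) ^ 2 := by exact_mod_cast G.degreeSumOn_le_sq U
  have hQ' : (1 - 1 / r : ℝ) * (#U : ℝ) ^ 2 + β / 2 * ((#U₀ : ℝ) ^ 2 - (#U : ℝ) ^ 2) <
    G.degreeSumOn U := hQ
  have hlarge : (#U₀ : ℝ) ^ 2 < (1 + 2 / (r * β)) * (#U : ℝ) ^ 2 := by
    have h1 : β / 2 * (#U₀ : ℝ) ^ 2 < (1 / r + β / 2) * (#U : ℝ) ^ 2 := by linarith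
    have h2 : (1 + 2 / (r * β)) * (#U : ℝ) ^ 2 = 2 / β * ((1 / r + β / 2) * (#U : ℝ) ^ 2) := by
      field_simp
      ring
    have h3 : (#U₀ : ℝ) ^ 2 = 2 / β * (β / 2 * (#U₀ : ℝ) ^ 2) := by field_simp
    rw [h2, h3]
    exact mul_lt_mul_of_pos_left h1 (by positivity)
  refine ⟨U, hUU₀, hlarge.le, ?_, ?_⟩
  · have : 0 ≤ β / 2 * ((#U₀ : ℝ) ^ 2 - (#U : ℝ) ^ 2) :=
      mul_nonneg (by positivity) (by linarith)
    linarith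
  · intro v hv
    by_contra! hdeg
    have hβU : 1 ≤ β * #U := by
      have hpos : 0 < (#U₀ : ℝ) ^ 2 := by
        by_contra! h0
        have : β ^ 2 * (#U₀ : ℝ) ^ 2 ≤ 0 := mul_nonpos_of_nonneg_of_nonpos (by positivity) h0
        have : 0 < 2 / (r * β) := by positivity
        linarith
      have h1 : (#U₀ : ℝ) ^ 2 < (β ^ 2 * (#U : ℝ) ^ 2) * (#U₀ : ℝ) ^ 2 :=
        hlarge.trans_le ((mul_le_mul_of_nonneg_right hU₀ (by positivity)).trans (by
          apply le_of_eq; ring))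
      have h2 : 1 < (β * #U) ^ 2 := by
        rw [mul_pow]
        by_contra! h3
        have := mul_le_mul_of_nonneg_right h3 hpos.le
        linarith
      by_contra! h3
      have : (0 : ℝ) ≤ β * #U := by positivity
      nlinarith
    have hsd := degreeSumOn_le_sdiff_add (G := G) (singleton_subset_iff.2 hv)
    rw [sum_singleton] at hsd
    have hsd' : (G.degreeSumOn U : ℝ) ≤ G.degreeSumOn (U \ {v}) + 2 * #{w ∈ U | G.Adj v w} := by
      exact_mod_cast hsd
    have hcard : (#(U \ {v}) : ℝ) = #U - 1 := by
      have := card_sdiff_add_card_eq_card (singleton_subset_iff.2 hv)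
      rw [card_singleton] at this
      rw [← this]; push_cast; ring
    -- Deleting v loses at most 2(1 - 1/r - β)|U| of the degree sum, while the threshold drops by (1
    -- - 1/r - β/2)(2|U| - 1), which is at least as much once β|U| ≥ 1.
    have hQv : Q (U \ {v}) := by
      simp only [Q]
      rw [hcard]
      have : 0 < 1 / (r : ℝ) := by positivity
      nlinarith
    have hle := hmin (U \ {v}) (mem_filter.2
      ⟨mem_powerset.2 (sdiff_subset.trans hUU₀), hQv⟩)
    have : (#U : ℝ) ≤ #(U \ {v}) := by exact_mod_cast hle
    linarith

end SimpleGraph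

/-! ### Numerical estimates, and the embedding with explicit constants. -/

namespace SimpleGraph

open Finset Function

lemma two_pow_le_exp (m : ℕ) : (2 : ℝ) ^ m ≤ Real.exp m := by
  rw [← Real.exp_one_pow]
  exact pow_le_pow_left₀ (by norm_num) (by linarith [Real.add_one_le_exp (1 : ℝ)]) m

section Estimates

variable {r n : ℕ} {c : ℝ}

/-- 27 is the value of (r + 7)(r + 1) at r = 2. -/
lemma pow_twenty_seven_le (hr : 2 ≤ r) : (r : ℝ) ^ 27 ≤ (r : ℝ) ^ ((r + 7) * (r + 1)) := by
  have : (1 : ℝ) ≤ r := by exact_mod_cast (by omega : 1 ≤ r)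
  exact pow_le_pow_right₀ this (by nlinarith)

lemma mul_two_mul_pow_le_one (hr : 2 ≤ r)
    (hc_upper : c ≤ ((r : ℝ) ^ ((r + 7) * (r + 1)))⁻¹ / 2) :
    c * (2 * (r : ℝ) ^ ((r + 7) * (r + 1))) ≤ 1 := by
  have hr0 : (0 : ℝ) < r := by exact_mod_cast (by omega : 0 < r)
  have hN : (0 : ℝ) < (r : ℝ) ^ ((r + 7) * (r + 1)) := by positivity
  refine (mul_le_mul_of_nonneg_right hc_upper (by positivity)).trans (le_of_eq ?_)
  field_simp

lemma two_le_mul_log (hn : 2 ≤ n) (hc_lower : 2 / Real.log n ≤ c) : 2 ≤ c * Real.log n := by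
  have hlog : 0 < Real.log n := Real.log_pos (by exact_mod_cast hn)
  rwa [div_le_iff₀ hlog] at hc_lower

lemma four_mul_pow_le_log (hr : 2 ≤ r) (hn : 2 ≤ n) (hc_lower : 2 / Real.log n ≤ c)
    (hc_upper : c ≤ ((r : ℝ) ^ ((r + 7) * (r + 1)))⁻¹ / 2) :
    4 * (r : ℝ) ^ ((r + 7) * (r + 1)) ≤ Real.log n := by
  have hlog : 0 < Real.log n := Real.log_pos (by exact_mod_cast hn)
  have h1 := mul_two_mul_pow_le_one hr hc_upper
  have h2 := two_le_mul_log hn hc_lower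
  have hN : (0 : ℝ) ≤ (r : ℝ) ^ ((r + 7) * (r + 1)) := by positivity
  have h3 := mul_le_mul_of_nonneg_left h1 hlog.le
  have h4 := mul_le_mul_of_nonneg_right h2 hN
  linarith

lemma pow_twenty_seven_le_cast (hr : 2 ≤ r) (hn : 2 ≤ n) (hc_lower : 2 / Real.log n ≤ c)
    (hc_upper : c ≤ ((r : ℝ) ^ ((r + 7) * (r + 1)))⁻¹ / 2) : (r : ℝ) ^ 27 ≤ n := by
  have hn0 : (0 : ℝ) < n := by exact_mod_cast (by omega : 0 < n)
  have h1 := four_mul_pow_le_log hr hn hc_lower hc_upper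
  have h2 := pow_twenty_seven_le hr
  have h3 := Real.log_le_sub_one_of_pos hn0
  have : (0 : ℝ) ≤ (r : ℝ) ^ 27 := by positivity
  linarith

/-- The factor 4r¹² combines β²/4 = r⁻⁸/4, where β = r⁻⁴, with a loss of r⁴ in passing from n to the
induced subgraph. -/
lemma small_parts_estimate (hr : 2 ≤ r) (hn : 2 ≤ n) (hc_lower : 2 / Real.log n ≤ c)
    (hc_upper : c ≤ ((r : ℝ) ^ ((r + 7) * (r + 1)))⁻¹ / 2) :
    ((⌊c * Real.log n⌋₊ * (4 * r ^ 8) ^ r : ℕ) : ℝ) *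
      2 ^ (⌊c * Real.log n⌋₊ * (4 * r ^ 8) ^ r) * (4 * (r : ℝ) ^ 12) ≤ n := by
  have hn0 : (0 : ℝ) < n := by exact_mod_cast (by omega : 0 < n)
  have hr2 : (2 : ℝ) ≤ r := by exact_mod_cast hr
  have hr0 : (0 : ℝ) < r := by linarith
  have hlog : 0 < Real.log n := Real.log_pos (by exact_mod_cast hn)
  have hcl := two_le_mul_log hn hc_lower
  have hc0 : 0 < c := pos_of_mul_pos_left (by linarith) hlog.le
  have hcN := mul_two_mul_pow_le_one hr hc_upper
  have hlogN := four_mul_pow_le_log hr hn hc_lower hc_upper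
  have hN := pow_twenty_seven_le hr
  set N := (r : ℝ) ^ ((r + 7) * (r + 1)) with hNdef
  -- The exponent of r in the bound on c enters here: 10r + 7 ≤ (r + 7)(r + 1), with equality at r =
  -- 2.
  have hL : (4 * (r : ℝ) ^ 8) ^ r * 128 ≤ N := by
    calc (4 * (r : ℝ) ^ 8) ^ r * 128 ≤ ((r : ℝ) ^ 10) ^ r * (r : ℝ) ^ 7 := by
          gcongr
          · calc 4 * (r : ℝ) ^ 8 ≤ (r : ℝ) ^ 2 * (r : ℝ) ^ 8 := by gcongr; nlinarith
              _ = (r : ℝ) ^ 10 := by ring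
          · calc (128 : ℝ) = 2 ^ 7 := by norm_num
              _ ≤ (r : ℝ) ^ 7 := by gcongr
      _ = (r : ℝ) ^ (10 * r + 7) := by rw [← pow_mul, ← pow_add]
      _ ≤ N := pow_le_pow_right₀ (by linarith) (by nlinarith)
  set m := ⌊c * Real.log n⌋₊ * (4 * r ^ 8) ^ r with hm
  have hmle : (m : ℝ) * 4 ≤ Real.log n := by
    have h1 : (m : ℝ) ≤ c * Real.log n * (4 * (r : ℝ) ^ 8) ^ r := by
      rw [hm]
      push_cast
      gcongr
      exact Nat.floor_le (by positivity)
    have h2 := mul_le_mul_of_nonneg_left hL (by positivity : 0 ≤ c * Real.log n)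
    have h3 := mul_le_mul_of_nonneg_left hcN hlog.le
    linarith
  have hmm : (m : ℝ) * 2 ^ m ≤ Real.exp (Real.log n / 2) := by
    have h1 : (m : ℝ) ≤ 2 ^ m := by exact_mod_cast Nat.lt_two_pow_self.le
    calc (m : ℝ) * 2 ^ m ≤ 2 ^ m * 2 ^ m := by gcongr
      _ ≤ Real.exp m * Real.exp m := by gcongr <;> exact two_pow_le_exp m
      _ = Real.exp (m + m) := (Real.exp_add _ _).symm
      _ ≤ _ := Real.exp_le_exp.2 (by linarith)
  have hfac : 4 * (r : ℝ) ^ 12 ≤ Real.exp (Real.log n / 2) := by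
    have h1 := Real.add_one_le_exp (Real.log n / 2)
    have h2 : 4 * (r : ℝ) ^ 12 ≤ (r : ℝ) ^ 27 := by
      calc 4 * (r : ℝ) ^ 12 ≤ (r : ℝ) ^ 2 * (r : ℝ) ^ 12 := by gcongr; nlinarith
        _ = (r : ℝ) ^ 14 := by ring
        _ ≤ _ := pow_le_pow_right₀ (by linarith) (by norm_num)
    have : (0 : ℝ) ≤ (r : ℝ) ^ 27 := by positivity
    linarith
  calc (m : ℝ) * 2 ^ m * (4 * (r : ℝ) ^ 12) ≤
      Real.exp (Real.log n / 2) * Real.exp (Real.log n / 2) := by gcongr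
    _ = n := by rw [← Real.exp_add, add_halves, Real.exp_log hn0]

lemma large_part_estimate (hr : 2 ≤ r) (hn : 2 ≤ n) (hc_lower : 2 / Real.log n ≤ c)
    (hc_upper : c ≤ ((r : ℝ) ^ ((r + 7) * (r + 1)))⁻¹ / 2) :
    (⌈(n : ℝ) ^ (1 - 2 * √c)⌉₊ : ℝ) * 2 ^ (⌊c * Real.log n⌋₊ * (4 * r ^ 8)) *
      (4 * (r : ℝ) ^ 12) ≤ n := by
  have hn0 : (0 : ℝ) < n := by exact_mod_cast (by omega : 0 < n)
  have hn1 : (1 : ℝ) ≤ n := by exact_mod_cast (by omega : 1 ≤ n)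
  have hr2 : (2 : ℝ) ≤ r := by exact_mod_cast hr
  have hr0 : (0 : ℝ) < r := by linarith
  have hlog : 0 < Real.log n := Real.log_pos (by exact_mod_cast hn)
  have hcl := two_le_mul_log hn hc_lower
  have hc0 : 0 < c := pos_of_mul_pos_left (by linarith) hlog.le
  have hcN := mul_two_mul_pow_le_one hr hc_upper
  have hlogN := four_mul_pow_le_log hr hn hc_lower hc_upper
  have hN := pow_twenty_seven_le hr
  set N := (r : ℝ) ^ ((r + 7) * (r + 1)) with hNdef
  have hsq : √c * √c = c := Real.mul_self_sqrt hc0.le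
  have hsqpos : 0 < √c := Real.sqrt_pos.2 hc0
  have hpow : ∀ a b : ℕ, a + b ≤ 27 → (2 : ℝ) ^ a * (r : ℝ) ^ b ≤ N := fun a b hab =>
    calc (2 : ℝ) ^ a * (r : ℝ) ^ b ≤ (r : ℝ) ^ a * (r : ℝ) ^ b := by gcongr
      _ = (r : ℝ) ^ (a + b) := (pow_add _ _ _).symm
      _ ≤ (r : ℝ) ^ 27 := pow_le_pow_right₀ (by linarith) hab
      _ ≤ N := hN
  -- Half of a factor n^√c pays for the power of 2 (`hs`), and a full one for the constants
  -- (`hfac`); together they stay below the n^(2√c) given up in the size of the last part.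
  have hsmall : 8 * (r : ℝ) ^ 8 * √c ≤ 1 := by
    have h1 := hpow 5 16 (by norm_num)
    have h2 : (8 * (r : ℝ) ^ 8 * √c) * (8 * (r : ℝ) ^ 8 * √c) = c * (64 * (r : ℝ) ^ 16) := by
      linear_combination 64 * (r : ℝ) ^ 16 * hsq
    have h3 : c * (64 * (r : ℝ) ^ 16) ≤ c * (2 * N) :=
      mul_le_mul_of_nonneg_left (by linarith) hc0.le
    by_contra! h4
    nlinarith
  have hexp : (n : ℝ) ^ (1 - 2 * √c) = Real.exp (Real.log n * (1 - 2 * √c)) :=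
    Real.rpow_def_of_pos hn0 _
  have hsqle : 2 * √c ≤ 1 := by
    have : (1 : ℝ) ≤ (r : ℝ) ^ 8 := one_le_pow₀ (by linarith)
    nlinarith
  have ht : (⌈(n : ℝ) ^ (1 - 2 * √c)⌉₊ : ℝ) ≤ 2 * Real.exp (Real.log n * (1 - 2 * √c)) := by
    have h1 : (1 : ℝ) ≤ (n : ℝ) ^ (1 - 2 * √c) := Real.one_le_rpow hn1 (by linarith)
    have h2 := (Nat.ceil_lt_add_one (by linarith : (0 : ℝ) ≤ (n : ℝ) ^ (1 - 2 * √c))).le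
    rw [← hexp]
    linarith
  have hs : (2 : ℝ) ^ (⌊c * Real.log n⌋₊ * (4 * r ^ 8)) ≤ Real.exp (√c * Real.log n / 2) := by
    refine (two_pow_le_exp _).trans (Real.exp_le_exp.2 ?_)
    push_cast
    have h1 := Nat.floor_le (by positivity : 0 ≤ c * Real.log n)
    have h2 := mul_le_mul_of_nonneg_right h1 (by positivity : 0 ≤ 4 * (r : ℝ) ^ 8)
    have h3 := mul_le_mul_of_nonneg_left hsmall (by positivity : 0 ≤ √c * Real.log n / 2)
    have h4 : √c * Real.log n / 2 * (8 * (r : ℝ) ^ 8 * √c) =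
        c * Real.log n * (4 * (r : ℝ) ^ 8) := by
      linear_combination 4 * (r : ℝ) ^ 8 * Real.log n * hsq
    linarith
  have hfac : 8 * (r : ℝ) ^ 12 ≤ Real.exp (√c * Real.log n) := by
    have h1 := Real.quadratic_le_exp_of_nonneg (by positivity : 0 ≤ √c * Real.log n)
    have h2 := hpow 1 12 (by norm_num)
    have h3 : (√c * Real.log n) ^ 2 = c * Real.log n * Real.log n := by
      linear_combination Real.log n ^ 2 * hsq
    have h4 := mul_le_mul_of_nonneg_right hcl hlog.le
    have : 0 ≤ √c * Real.log n := by positivity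
    linarith
  calc (⌈(n : ℝ) ^ (1 - 2 * √c)⌉₊ : ℝ) * 2 ^ (⌊c * Real.log n⌋₊ * (4 * r ^ 8)) *
        (4 * (r : ℝ) ^ 12)
      ≤ 2 * Real.exp (Real.log n * (1 - 2 * √c)) * Real.exp (√c * Real.log n / 2) *
        (4 * (r : ℝ) ^ 12) := by gcongr
    _ = Real.exp (Real.log n * (1 - 2 * √c)) * Real.exp (√c * Real.log n / 2) *
        (8 * (r : ℝ) ^ 12) := by ring
    _ ≤ Real.exp (Real.log n * (1 - 2 * √c)) * Real.exp (√c * Real.log n / 2) *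
        Real.exp (√c * Real.log n) := by gcongr
    _ = Real.exp (Real.log n - √c * Real.log n / 2) := by
        rw [← Real.exp_add, ← Real.exp_add]; congr 1; ring
    _ ≤ Real.exp (Real.log n) := Real.exp_le_exp.2 (by
        have : 0 ≤ √c * Real.log n := by positivity
        linarith)
    _ = n := Real.exp_log hn0

end Estimates

variable {V : Type*} {G : SimpleGraph V} [DecidableRel G.Adj]

theorem completePartitePlus_isContained_of_induce [DecidableEq V] {r n : ℕ} {c : ℝ} (hr : 2 ≤ r)
    (hn : 2 ≤ n) (hc_lower : 2 / Real.log n ≤ c)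
    (hc_upper : c ≤ ((r : ℝ) ^ ((r + 7) * (r + 1)))⁻¹ / 2) {U : Finset V}
    (hU : (n : ℝ) ≤ (r : ℝ) ^ 4 * #U)
    (hdeg : ∀ v ∈ U, (#U : ℝ) - #{w ∈ U | G.Adj v w} ≤ (1 / r + ((r : ℝ) ^ 4)⁻¹) * #U)
    (hclique : ¬ (G.induce (U : Set V)).CliqueFree (r + 1)) :
    (completePartitePlus r (fun i : Fin r =>
      if i.val + 1 = r then ⌈(n : ℝ) ^ (1 - 2 * √c)⌉₊ else ⌊c * Real.log n⌋₊)).IsContained G := by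
  have hr2 : (2 : ℝ) ≤ r := by exact_mod_cast hr
  have hn0 : (0 : ℝ) < n := by exact_mod_cast (by omega : 0 < n)
  have hUpos : (0 : ℝ) < #U := by
    by_contra! h
    have := mul_nonpos_of_nonneg_of_nonpos (by positivity : (0 : ℝ) ≤ (r : ℝ) ^ 4) h
    linarith
  have hcard : (Fintype.card (U : Set V) : ℝ) = #U := by simp
  have hne : Nonempty (U : Set V) := by
    obtain ⟨v, hv⟩ := card_pos.1 (by exact_mod_cast hUpos : 0 < #U)
    exact ⟨⟨v, hv⟩⟩
  have hs := small_parts_estimate hr hn hc_lower hc_upper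
  have ht := large_part_estimate hr hn hc_lower hc_upper
  have hs2 := two_le_mul_log hn hc_lower
  have hr0 : (0 : ℝ) < r := by linarith
  have hbound : ∀ x : ℝ, x * (4 * (r : ℝ) ^ 12) ≤ n →
      x ≤ (((r : ℝ) ^ 4)⁻¹) ^ 2 / 2 / 2 * #U := by
    intro x hx
    have h1 : x * (4 * (r : ℝ) ^ 12) ≤
        ((((r : ℝ) ^ 4)⁻¹) ^ 2 / 2 / 2 * #U) * (4 * (r : ℝ) ^ 12) := by
      refine (hx.trans hU).trans (le_of_eq ?_)
      field_simp
      ring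
    exact le_of_mul_le_mul_right h1 (by positivity)
  refine IsContained.trans ?_ ⟨(Embedding.induce (U : Set V)).toCopy⟩
  obtain ⟨e, rfl⟩ := Nat.exists_eq_add_of_le' hr
  have hcube : (0 : ℝ) ≤ ((e + 2 : ℕ) : ℝ) - 2 := by linarith
  set R : ℝ := ((e + 2 : ℕ) : ℝ) with hR
  -- With β = r⁻⁴ the extension proportion is β²/2 = r⁻⁸/2, and L is its inverse doubled.
  refine completePartitePlus_isContained_of_degree (β := (R ^ 4)⁻¹) (L := 4 * (e + 2) ^ 8)
    (by positivity) ?_ ?_ ?_ hclique (Nat.le_floor (by exact_mod_cast hs2))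
    (Nat.ceil_pos.2 (by positivity)) ?_ ?_ ?_
  · rw [← hR, ← div_eq_mul_inv, div_le_iff₀ (by positivity)]
    nlinarith [pow_pos hr0 2, pow_pos hr0 3, mul_nonneg hcube (pow_pos hr0 2).le,
      mul_nonneg hcube (pow_pos hr0 3).le]
  · rw [← hR, ← div_eq_mul_inv, div_le_iff₀ (by positivity)]
    rw [one_mul]
    exact pow_le_pow_right₀ (by linarith) (by norm_num)
  · intro v
    rw [hcard, degree_induce_eq]
    exact hdeg v v.2
  · push_cast
    have : (e : ℝ) + 2 = R := by rw [hR]; push_cast; ring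
    rw [this]
    apply le_of_eq
    field_simp
    norm_num
  · rw [hcard]
    exact hbound _ hs
  · rw [hcard]
    exact hbound _ ht

end SimpleGraph

/-! ### The cases: excess density, few vertices of small degree, small deficiency. -/

namespace SimpleGraph

open Finset Function

variable {V : Type*} {G : SimpleGraph V} [DecidableRel G.Adj] {r n : ℕ} {c : ℝ}

/-- A graph whose density exceeds that of a balanced complete `r`-partite graph contains a large
complete `r`-partite graph with an extra edge in the first part. -/
theorem completePartitePlus_isContained_of_lt_degreeSumOn [DecidableEq V] (hr : 2 ≤ r) (hn : 2 ≤ n)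
    (hc_lower : 2 / Real.log n ≤ c) (hc_upper : c ≤ ((r : ℝ) ^ ((r + 7) * (r + 1)))⁻¹ / 2)
    {U₀ : Finset V} (hU₀ : (n : ℝ) ≤ 2 * #U₀)
    (h : (1 - 1 / r : ℝ) * (#U₀ : ℝ) ^ 2 < G.degreeSumOn U₀) :
    (completePartitePlus r (fun i : Fin r =>
      if i.val + 1 = r then ⌈(n : ℝ) ^ (1 - 2 * √c)⌉₊ else ⌊c * Real.log n⌋₊)).IsContained G := by
  have hr2 : (2 : ℝ) ≤ r := by exact_mod_cast hr
  have hr0 : (0 : ℝ) < r := by linarith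
  have hnr := pow_twenty_seven_le_cast hr hn hc_lower hc_upper
  have hratio : 1 + 2 / (r * ((r : ℝ) ^ 4)⁻¹) = 1 + 2 * (r : ℝ) ^ 3 := by field_simp
  have hpow5 : 4 * (1 + 2 * (r : ℝ) ^ 3) ≤ (r : ℝ) ^ 8 := by
    have h3 : (2 : ℝ) ^ 3 ≤ (r : ℝ) ^ 3 := by gcongr
    have h5 : (2 : ℝ) ^ 5 ≤ (r : ℝ) ^ 5 := by gcongr
    have h8 : (r : ℝ) ^ 8 = (r : ℝ) ^ 5 * (r : ℝ) ^ 3 := by ring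
    rw [h8]
    nlinarith
  have hU₀r : (r : ℝ) ^ 8 ≤ #U₀ := by
    have h1 : 2 * (r : ℝ) ^ 8 ≤ (r : ℝ) * (r : ℝ) ^ 8 := by gcongr
    have h2 : (r : ℝ) * (r : ℝ) ^ 8 ≤ (r : ℝ) ^ 27 := by
      rw [← pow_succ']
      exact pow_le_pow_right₀ (by linarith) (by norm_num)
    linarith
  obtain ⟨U, -, hUcard, hUD, hUdeg⟩ := exists_subset_large_degree (r := r)
    (β := ((r : ℝ) ^ 4)⁻¹) (by omega) (by positivity) (by
      rw [hratio]
      have h1 : (((r : ℝ) ^ 4)⁻¹) ^ 2 * ((r : ℝ) ^ 8) ^ 2 = (r : ℝ) ^ 8 := by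
        field_simp
      calc 1 + 2 * (r : ℝ) ^ 3 ≤ (r : ℝ) ^ 8 := by
            have : 0 < (r : ℝ) ^ 3 := by positivity
            linarith
        _ = (((r : ℝ) ^ 4)⁻¹) ^ 2 * ((r : ℝ) ^ 8) ^ 2 := h1.symm
        _ ≤ _ := by gcongr) h
  rw [hratio] at hUcard
  refine completePartitePlus_isContained_of_induce hr hn hc_lower hc_upper (U := U) ?_
    (fun v hv => ?_) (not_cliqueFree_induce_of_lt (by omega) hUD)
  · refine le_of_sq_le_sq ?_ (by positivity)
    calc (n : ℝ) ^ 2 ≤ (2 * #U₀) ^ 2 := by gcongr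
      _ = 4 * (#U₀ : ℝ) ^ 2 := by ring
      _ ≤ 4 * ((1 + 2 * (r : ℝ) ^ 3) * (#U : ℝ) ^ 2) := by gcongr
      _ = 4 * (1 + 2 * (r : ℝ) ^ 3) * (#U : ℝ) ^ 2 := by ring
      _ ≤ (r : ℝ) ^ 8 * (#U : ℝ) ^ 2 := by gcongr
      _ = ((r : ℝ) ^ 4 * #U) ^ 2 := by ring
  · linarith [hUdeg v hv]

/-- A `K_{r+1}`-free graph in which every vertex has few non-neighbors is `r`-colorable. -/
lemma colorable_of_cliqueFree_of_degree [Fintype V] [Nonempty V] {β : ℝ} (hr : 2 ≤ r)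
    (hβ : r * (3 * r - 1) * β < 1)
    (hdeg : ∀ v, (Fintype.card V : ℝ) - G.degree v ≤ (1 / r + β) * Fintype.card V)
    (hfree : G.CliqueFree (r + 1)) : G.Colorable r := by
  refine colorable_of_cliqueFree_lt_minDegree hfree ?_
  obtain ⟨v, hv⟩ := G.exists_minimal_degree_vertex
  rw [hv, Nat.div_lt_iff_lt_mul (by omega)]
  have hr2 : (2 : ℝ) ≤ r := by exact_mod_cast hr
  have hk : (0 : ℝ) < Fintype.card V := by exact_mod_cast Fintype.card_pos
  have h1 : (((3 * r - 4) * Fintype.card V : ℕ) : ℝ) < ((G.degree v * (3 * r - 1) : ℕ) : ℝ) := by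
    rw [Nat.cast_mul, Nat.cast_mul, Nat.cast_sub (by omega), Nat.cast_sub (by omega)]
    push_cast
    have h2 := mul_le_mul_of_nonneg_right (hdeg v) (by linarith : (0 : ℝ) ≤ 3 * r - 1)
    -- The Andrásfai–Erdős–Sós threshold (3r - 4)/(3r - 1) equals 1 - 3/(3r - 1), and 3/(3r - 1) -
    -- 1/r = 1/(r(3r - 1)) exceeds β.
    have h3 : (1 / r + β) * (3 * r - 1) < 3 := by
      refine lt_of_mul_lt_mul_left ?_ (by linarith : (0 : ℝ) ≤ r)
      have : (r : ℝ) * ((1 / r + β) * (3 * r - 1)) = (3 * r - 1) + r * (3 * r - 1) * β := by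
        field_simp
      linarith
    have h4 := mul_lt_mul_of_pos_right h3 hk
    linarith
  exact_mod_cast h1

lemma card_filter_sdiff_ge [Fintype V] [DecidableEq V] (M : Finset V) (v : V) :
    (G.degree v : ℝ) - #M ≤ #{w ∈ univ \ M | G.Adj v w} := by
  have h1 : {w ∈ univ \ M | G.Adj v w} = G.neighborFinset v \ M := by
    ext w
    simp only [mem_filter, mem_sdiff, mem_univ, true_and, mem_neighborFinset, and_comm]
  have h2 := le_card_sdiff M (G.neighborFinset v)
  rw [h1, ← card_neighborFinset_eq_degree]
  have h3 : #(G.neighborFinset v) ≤ #(G.neighborFinset v \ M) + #M := by omega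
  have : (#(G.neighborFinset v) : ℝ) ≤ #(G.neighborFinset v \ M) + #M := by exact_mod_cast h3
  linarith

lemma sub_le_degreeSumOn_univ_sdiff [Fintype V] [DecidableEq V] {M : Finset V} {d : ℝ}
    (hM : ∀ v ∈ M, (G.degree v : ℝ) ≤ d) :
    (2 * #G.edgeFinset : ℝ) - 2 * (#M * d) ≤ G.degreeSumOn (univ \ M) := by
  have h1 := degreeSumOn_le_sdiff_add (G := G) (subset_univ M)
  rw [degreeSumOn_univ] at h1
  have h2 : (2 * #G.edgeFinset : ℝ) ≤
      G.degreeSumOn (univ \ M) + 2 * ∑ v ∈ M, (#{w | G.Adj v w} : ℝ) := by exact_mod_cast h1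
  have h3 : ∑ v ∈ M, (#{w | G.Adj v w} : ℝ) ≤ #M * d := by
    rw [← nsmul_eq_mul]
    refine sum_le_card_nsmul _ _ _ fun v hv => ?_
    rw [← neighborFinset_eq_filter, card_neighborFinset_eq_degree]
    exact hM v hv
  linarith

/-- If few vertices have small degree, then removing them leaves an `r`-colorable graph of large
minimum degree, or there is a large complete `r`-partite subgraph with an extra edge. -/
lemma exists_colorable_of_few_small_degrees [Fintype V] [DecidableEq V] {ε : ℝ} (hr : 2 ≤ r)
    (hn : 2 ≤ n) (hV : Fintype.card V = n) (hc_lower : 2 / Real.log n ≤ c)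
    (hc_upper : c ≤ ((r : ℝ) ^ ((r + 7) * (r + 1)))⁻¹ / 2) (hε₀ : 0 < ε)
    (hε : 2 * ε ≤ ((r : ℝ) ^ 4)⁻¹) {M : Finset V} (hM : (#M : ℝ) ≤ ε * n)
    (hdeg : ∀ v ∉ M, (1 - 1 / r - ε) * n < G.degree v) :
    (completePartitePlus r (fun i : Fin r =>
      if i.val + 1 = r then ⌈(n : ℝ) ^ (1 - 2 * √c)⌉₊ else ⌊c * Real.log n⌋₊)).IsContained G ∨
    ∃ U : Finset V, (1 - ε) * (n : ℝ) ≤ (U.card : ℝ) ∧ (G.induce (U : Set V)).Colorable r ∧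
      (1 - 1 / (r : ℝ) - 2 * ε) * (n : ℝ) < ((G.induce (U : Set V)).minDegree : ℝ) := by
  have hr2 : (2 : ℝ) ≤ r := by exact_mod_cast hr
  have hr0 : (0 : ℝ) < r := by linarith
  have hn0 : (0 : ℝ) < n := by exact_mod_cast (by omega : 0 < n)
  have hB : ((r : ℝ) ^ 4)⁻¹ ≤ 1 / 16 := by
    rw [inv_eq_one_div]
    have : (2 : ℝ) ^ 4 ≤ (r : ℝ) ^ 4 := by gcongr
    exact one_div_le_one_div_of_le (by norm_num) (by linarith)
  have hrinv : 1 / (r : ℝ) ≤ 1 / 2 := one_div_le_one_div_of_le (by norm_num) hr2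
  have hrinv0 : 0 < 1 / (r : ℝ) := by positivity
  set B := ((r : ℝ) ^ 4)⁻¹ with hBdef
  have hB0 : 0 < B := by positivity
  set U : Finset V := univ \ M with hU
  have hcard : (#U : ℝ) = n - #M := by
    have h1 := card_sdiff_add_card_eq_card (subset_univ M)
    rw [card_univ, hV] at h1
    have : (#U : ℝ) + #M = n := by exact_mod_cast h1
    linarith
  have hUlarge : (1 - ε) * n ≤ #U := by rw [hcard]; linarith
  have hUdeg : ∀ v ∈ U, (1 - 1 / r - ε) * n - #M < #{w ∈ U | G.Adj v w} := by
    intro v hv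
    have h1 := card_filter_sdiff_ge (G := G) M v
    have h2 := hdeg v (by simpa [hU] using hv)
    linarith
  have hmiss : ∀ v ∈ U, (#U : ℝ) - #{w ∈ U | G.Adj v w} ≤ (1 / r + B) * #U := by
    intro v hv
    have h1 := hUdeg v hv
    -- In |U| minus the degree inside `U`, the size of `M` cancels, so at most (1/r + ε)n vertices
    -- are missed; this is compared with |U| ≥ (1 - ε)n.
    have h2 : (1 / r + ε) ≤ (1 / r + B) * (1 - ε) := by nlinarith
    have h3 := mul_le_mul_of_nonneg_right h2 hn0.le
    have h4 := mul_le_mul_of_nonneg_left hUlarge (by positivity : 0 ≤ 1 / r + B)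
    linarith
  have hUn : (n : ℝ) ≤ (r : ℝ) ^ 4 * #U := by
    have h1 : (2 : ℝ) ^ 4 ≤ (r : ℝ) ^ 4 := by gcongr
    have h2 : (n : ℝ) / 2 ≤ #U := by nlinarith
    nlinarith
  have hUpos : (0 : ℝ) < #U := by
    have : 0 < (1 - ε) * n := mul_pos (by linarith) hn0
    linarith
  have hne : Nonempty (U : Set V) := by
    obtain ⟨v, hv⟩ := card_pos.1 (by exact_mod_cast hUpos : 0 < #U)
    exact ⟨⟨v, hv⟩⟩
  by_cases hfree : (G.induce (U : Set V)).CliqueFree (r + 1)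
  · refine Or.inr ⟨U, hUlarge, colorable_of_cliqueFree_of_degree (β := B) hr ?_ ?_ hfree, ?_⟩
    · rw [hBdef, ← div_eq_mul_inv, div_lt_one (by positivity)]
      nlinarith [pow_pos hr0 2, mul_nonneg (sub_nonneg.2 hr2) (pow_pos hr0 2).le,
        mul_nonneg (sub_nonneg.2 hr2) (pow_pos hr0 3).le]
    · intro v
      rw [degree_induce_eq, show (Fintype.card (U : Set V) : ℝ) = #U by simp]
      exact hmiss v v.2
    · obtain ⟨v, hv⟩ := (G.induce (U : Set V)).exists_minimal_degree_vertex
      rw [hv, degree_induce_eq]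
      have := hUdeg v v.2
      linarith
  · exact Or.inl (completePartitePlus_isContained_of_induce hr hn hc_lower hc_upper hUn hmiss hfree)

/-- If a graph of almost balanced `r`-partite density has a vertex of degree below the average of
the balanced complete `r`-partite graph, then it contains a large complete `r`-partite graph with
an extra edge in the first part. -/
lemma completePartitePlus_isContained_of_small_deficiency [Fintype V] [DecidableEq V] {x : ℝ}
    (hr : 2 ≤ r) (hn : 2 ≤ n) (hV : Fintype.card V = n) (hc_lower : 2 / Real.log n ≤ c)
    (hc_upper : c ≤ ((r : ℝ) ^ ((r + 7) * (r + 1)))⁻¹ / 2) (hx₀ : 0 < x) (hx : x < 1)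
    (hG : (1 - 1 / r : ℝ) * (n : ℝ) ^ 2 - x ^ 2 / 2 ≤ 2 * #G.edgeFinset) {v : V}
    (hv : (G.degree v : ℝ) ≤ (1 - 1 / r) * n - x) :
    (completePartitePlus r (fun i : Fin r =>
      if i.val + 1 = r then ⌈(n : ℝ) ^ (1 - 2 * √c)⌉₊ else ⌊c * Real.log n⌋₊)).IsContained G := by
  have hr2 : (2 : ℝ) ≤ r := by exact_mod_cast hr
  have hr0 : (0 : ℝ) < r := by linarith
  have hn2 : (2 : ℝ) ≤ n := by exact_mod_cast hn
  have hrinv0 : 0 < 1 / (r : ℝ) := by positivity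
  have hx2 : x ^ 2 < 1 := by nlinarith
  have hremove : ∀ u, (G.degree u : ℝ) ≤ (1 - 1 / r) * n - 1 →
      (completePartitePlus r (fun i : Fin r =>
        if i.val + 1 = r then ⌈(n : ℝ) ^ (1 - 2 * √c)⌉₊ else ⌊c * Real.log n⌋₊)).IsContained G := by
    intro u hu
    have hcard : (#(univ \ {u} : Finset V) : ℝ) = n - 1 := by
      have h1 := card_sdiff_add_card_eq_card (subset_univ ({u} : Finset V))
      rw [card_univ, hV, card_singleton] at h1
      have : (#(univ \ {u} : Finset V) : ℝ) + 1 = n := by exact_mod_cast h1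
      linarith
    refine completePartitePlus_isContained_of_lt_degreeSumOn hr hn hc_lower hc_upper
      (U₀ := univ \ {u}) (by rw [hcard]; linarith) ?_
    have h1 := sub_le_degreeSumOn_univ_sdiff (G := G) (M := {u}) (d := (1 - 1 / r) * n - 1)
      (fun w hw => by rwa [mem_singleton.1 hw])
    rw [card_singleton, Nat.cast_one] at h1
    rw [hcard]
    nlinarith
  by_cases hmin : ∀ u, (1 - 1 / r - ((r : ℝ) ^ 4)⁻¹) * n < G.degree u
  · by_cases hfree : G.CliqueFree (r + 1)
    · have h1 := hfree.two_mul_card_edgeFinset_le (by omega : 0 < r)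
      rw [hV] at h1
      have h2 := mul_le_mul_of_nonneg_left hG hr0.le
      have h3 : (r : ℝ) * ((1 - 1 / r : ℝ) * (n : ℝ) ^ 2 - x ^ 2 / 2) =
          (r - 1) * (n : ℝ) ^ 2 - r * x ^ 2 / 2 := by
        field_simp
      -- A nonzero remainder s would give s(r - s) ≥ r - 1 ≥ r/2, so r divides n. Then (1 - 1/r)n is
      -- an integer, and the deficiency x > 0 of the degree of v is in fact at least 1.
      have h4 : ((n % r : ℕ) : ℝ) * (r - (n % r : ℕ)) < r / 2 := by nlinarith
      have hmod : n % r = 0 := by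
        by_contra hne
        have h5 : (1 : ℝ) ≤ (n % r : ℕ) := by exact_mod_cast Nat.one_le_iff_ne_zero.2 hne
        have h6 : ((n % r : ℕ) : ℝ) + 1 ≤ r := by exact_mod_cast Nat.mod_lt _ (by omega : 0 < r)
        nlinarith
      obtain ⟨q, hq⟩ := Nat.dvd_of_mod_eq_zero hmod
      have hqn : (1 - 1 / r : ℝ) * n = ((n : ℝ) - q) := by
        rw [hq]
        push_cast
        field_simp
      have h7 : G.degree v + q < n := by
        have : (G.degree v : ℝ) + q < n := by linarith
        exact_mod_cast this
      have h8 : (G.degree v : ℝ) + q + 1 ≤ n := by exact_mod_cast h7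
      exact hremove v (by linarith)
    · refine completePartitePlus_isContained_of_induce hr hn hc_lower hc_upper (U := univ) ?_ ?_ ?_
      · rw [card_univ, hV]
        have : (1 : ℝ) ≤ (r : ℝ) ^ 4 := one_le_pow₀ (by linarith)
        nlinarith
      · intro u _
        rw [card_univ, hV, ← neighborFinset_eq_filter, card_neighborFinset_eq_degree]
        linarith [hmin u]
      · rwa [← cliqueFreeOn_univ, ← coe_univ, ← cliqueFree_induce_iff] at hfree
  · push Not at hmin
    obtain ⟨u, hu⟩ := hmin
    refine hremove u (hu.trans ?_)
    have h1 : (r : ℝ) ^ 4 ≤ n := (pow_le_pow_right₀ (by linarith) (by norm_num)).trans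
      (pow_twenty_seven_le_cast hr hn hc_lower hc_upper)
    have h2 : 1 ≤ ((r : ℝ) ^ 4)⁻¹ * n := by
      rw [inv_mul_eq_div, le_div_iff₀ (by positivity)]
      linarith
    linarith

end SimpleGraph

/-! ### The main theorem. -/

open SimpleGraph Finset in
theorem theorem3 {V : Type*} [Fintype V] [DecidableEq V] (G : SimpleGraph V)
    [DecidableRel G.Adj] (r n : ℕ) (c α : ℝ)
    (hr : 2 ≤ r) (hn : 2 ≤ n) (hV : Fintype.card V = n)
    (hc_lower : 2 / Real.log n ≤ c)
    (hc_upper : c ≤ ((r : ℝ) ^ ((r + 7) * (r + 1)))⁻¹ / 2)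
    (hα_pos : 0 < α) (hα_lt : α < ((r : ℝ) ^ 8)⁻¹ / 8)
    (hG : G.edgeFinset.card = ⌈(1 - 1 / (r : ℝ) - α) * (n : ℝ) ^ 2 / 2⌉₊) :
    (completePartitePlus r (fun i : Fin r =>
        if i.val + 1 = r then ⌈(n : ℝ) ^ (1 - 2 * √c)⌉₊ else ⌊c * Real.log n⌋₊)).IsContained G ∨
    ∃ U : Finset V,
      (1 - √(2 * α)) * (n : ℝ) ≤ (U.card : ℝ) ∧
      (G.induce (U : Set V)).Colorable r ∧
      (1 - 1 / (r : ℝ) - 2 * √(2 * α)) * (n : ℝ) < ((G.induce (U : Set V)).minDegree : ℝ) := by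
  have hr2 : (2 : ℝ) ≤ r := by exact_mod_cast hr
  have hr0 : (0 : ℝ) < r := by linarith
  have hn0 : (0 : ℝ) < n := by exact_mod_cast (by omega : 0 < n)
  have hrinv0 : 0 < 1 / (r : ℝ) := by positivity
  set ε := √(2 * α) with hεdef
  have hεsq : ε ^ 2 = 2 * α := Real.sq_sqrt (by positivity)
  have hε0 : 0 < ε := Real.sqrt_pos.2 (by positivity)
  have hε : 2 * ε ≤ ((r : ℝ) ^ 4)⁻¹ := by
    refine le_of_sq_le_sq ?_ (by positivity)
    have : (((r : ℝ) ^ 4)⁻¹) ^ 2 = ((r : ℝ) ^ 8)⁻¹ := by rw [inv_pow, ← pow_mul]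
    rw [this, mul_pow, hεsq]
    linarith
  have hε1 : 2 * ε ≤ 1 := hε.trans (inv_le_one_of_one_le₀ (one_le_pow₀ (by linarith)))
  have hedges : (1 - 1 / r : ℝ) * (n : ℝ) ^ 2 - (ε * n) ^ 2 / 2 ≤ 2 * #G.edgeFinset := by
    rw [hG, mul_pow, hεsq]
    have := Nat.le_ceil ((1 - 1 / (r : ℝ) - α) * (n : ℝ) ^ 2 / 2)
    linarith
  set M : Finset V := {v | (G.degree v : ℝ) ≤ (1 - 1 / r - ε) * n} with hMdef
  by_cases hM : (#M : ℝ) ≤ ε * n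
  · exact exists_colorable_of_few_small_degrees hr hn hV hc_lower hc_upper hε0 hε hM
      fun v hv => by simpa [hMdef] using hv
  · left
    rw [not_le] at hM
    have hMdeg : ∀ v ∈ M, (G.degree v : ℝ) ≤ (1 - 1 / r) * n - ε * n := fun v hv => by
      have : (G.degree v : ℝ) ≤ (1 - 1 / r - ε) * n := by simpa [hMdef] using hv
      linarith
    set x := ε * n with hx
    have hx0 : 0 < x := by positivity
    rcases lt_or_ge x 1 with hx1 | hx1
    · obtain ⟨v, hv⟩ : M.Nonempty := by
        rw [← card_pos]
        exact_mod_cast hx0.trans hM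
      exact completePartitePlus_isContained_of_small_deficiency hr hn hV hc_lower hc_upper hx0 hx1
        hedges (hMdeg v hv)
    -- Only ⌊x⌋ vertices are deleted, so that at least half of the vertices remain even if `M` is
    -- huge.
    · obtain ⟨M', hM'M, hM'⟩ := exists_subset_card_eq (s := M) (n := ⌊x⌋₊)
        (by exact_mod_cast (Nat.floor_le hx0.le).trans hM.le)
      have hm1 : (1 : ℝ) ≤ ⌊x⌋₊ := by exact_mod_cast Nat.le_floor (by exact_mod_cast hx1)
      have hmx : (⌊x⌋₊ : ℝ) ≤ x := Nat.floor_le hx0.le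
      have hxm : x < ⌊x⌋₊ + 1 := Nat.lt_floor_add_one x
      have hcard : (#(univ \ M') : ℝ) = n - ⌊x⌋₊ := by
        have h1 := card_sdiff_add_card_eq_card (subset_univ M')
        rw [card_univ, hV, hM'] at h1
        have : (#(univ \ M') : ℝ) + ⌊x⌋₊ = n := by exact_mod_cast h1
        linarith
      refine completePartitePlus_isContained_of_lt_degreeSumOn hr hn hc_lower hc_upper
        (U₀ := univ \ M') ?_ ?_
      · rw [hcard]
        nlinarith
      · have h1 := sub_le_degreeSumOn_univ_sdiff (G := G) (M := M')
          (d := (1 - 1 / r) * n - x) fun v hv => hMdeg v (hM'M hv)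
        rw [hM'] at h1
        rw [hcard]
        set m : ℝ := (⌊x⌋₊ : ℝ)
        have h2 : 0 ≤ (x - m) * (m + 1 - x) := mul_nonneg (by linarith) (by linarith)
        have h3 : 0 < 1 / (r : ℝ) * m ^ 2 := by positivity
        -- Writing x = m + t with 0 ≤ t < 1, the difference of the two sides is m²/2 + mt - t²/2,
        -- nonnegative because m ≥ 1. The strict gain over Turán's density is the m²/r of `h3`.
        have h4 : m ^ 2 ≤ 2 * m * x - x ^ 2 / 2 := by nlinarith
        linarith
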